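/- **Setting.** Let $0<\mu<1$, $E=(-\tfrac12,0)$, $M=(\tfrac12,0)$, and consider the Euler problem of two fixed centers $$H(q,p)=\tfrac12|p|^2+V(q),\qquad V(q)=-\frac{1-\mu}{|q-E|}-\frac{\mu}{|q-M|},$$ with first integral $G=-H+2B$, $B=-L^2+Lp_2-\frac{(1-\mu)x_1}{|q-E|}-\frac{\mu(1-x_1)}{|q-M|}$, where $x=q+(\tfrac12,0)$ and $L=x_1p_2-x_2p_1$. Let $c_1=-1-2\sqrt{\mu(1-\mu)}$ be the critical value of $H$. In elliptic coordinates $q=(\tfrac12\cosh\lambda\cos\nu,\tfrac12\sinh\lambda\sin\nu)$ with conjugate momenta $p_\lambda,p_\nu$, the dynamics on $\{H=c\}$ is regularized at collisions by the Hamiltonian $$K=(\cosh^2\lambda-\cos^2\nu)(H-c)=K_\lambda+K_\nu,$$ $$K_\lambda=2p_\lambda^2-2\cosh\lambda-c\cosh^2\lambda,\qquad K_\nu=2p_\nu^2+2(1-2\mu)\cos\nu+c\cos^2\nu,$$ on the level $K=0$, where $G=K_\lambda$. Orbits are the projections to the $q$-plane of trajectories of the flow of $K$ on this level. Let $c<c_1$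 and let $(g,c)$ be a value of $(G,H)$ in the region $S$, i.e. $-2<g+c<-2|1-2\mu|$, or in the region $S'$, i.e. $-2|1-2\mu|<g+c<2|1-2\mu|$. Let $P\in\{E,M\}$ and let $\mathcal K_c^P$ be the connected component containing $P$ of Hill's region $\{q: V(q)\le c\}$ (with $V=-\infty$ at $E$ and $M$). The part over $\mathcal K_c^P$ of the regularized level set $\{G=g,\ H=c\}$ is, if it is not empty, a Liouville torus (in $S$ there is one around each center, in $S'$ only one, around the heavier center). Let $T_\lambda,T_\nu$ be the minimal periods of the flows of $K_\lambda$, $K_\nu$ on it. For relatively prime integers $k,l\ge1$, the torus is called a $T_{k,l}$-torus if $T_\nu/T_\lambda=k/l$. A periodic orbit with inverse self-tangencies (it passes twice through a point, with nonzero velocities of opposite directions) is called *brake-brake* if it touches the boundary of $\mathcal K_c^P$ at two distinct points, and *brake-collision* if it touches the boundary of $\mathcal K_c^P$ and also collides with $P$. A *quadruple point* of a periodic orbit is a point of the plane through which the orbit passes exactly four times during one minimal period. **Proposition.** Fix a $T_{k,l}$-torus as above. 1. If $k+l$ is odd, the torus contains exactly one brake-brake orbit (orbits being identified with their images in the $q$-plane),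 and this orbit has exactly $$(k-1)(l-1)+\frac{k+l-1}{2}$$ quadruple points. 2. If $k+l$ is even, the torus contains exactly two brake-collision orbits (orbits being identified with their images in the $q$-plane), and each of them has exactly $$\frac{(k-1)(l-1)}{4}$$ quadruple points. -/

import Mathlib

namespace EulerProblem

noncomputable section

/-- The plane with its Euclidean norm. -/
abbrev Plane := EuclideanSpace ℝ (Fin 2)

/-- The two fixed centers. -/
inductive Primary
  | earth
  | moon

/-- Position of the centers: `E = (-1/2, 0)` and `M = (1/2, 0)`. -/
def Primary.pos : Primary → Plane
  | Primary.earth => !₂[-1 / 2, 0]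
  | Primary.moon => !₂[1 / 2, 0]

/-- The potential `V(q) = -(1-μ)/|q-E| - μ/|q-M|`, meaningful for `q ≠ E, M`. -/
def potential (μ : ℝ) (q : Plane) : ℝ :=
  -(1 - μ) / dist q Primary.earth.pos - μ / dist q Primary.moon.pos

/-- The Hamiltonian of the Euler problem of two fixed centers. -/
def hamiltonian (μ : ℝ) (q p : Plane) : ℝ :=
  ‖p‖ ^ 2 / 2 + potential μ q

/-- Angular momentum with respect to the Earth. -/
def angularMomentum (q p : Plane) : ℝ := (q 0 + 1 / 2) * p 1 - q 1 * p 0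

/-- The first integral `G = -H + 2B`, where, in coordinates `x = q + (1/2, 0)` centered at the
Earth, `B = -L² + L p₂ - (1-μ) x₁ / |q-E| - μ (1 - x₁) / |q-M|`. -/
def firstIntegral (μ : ℝ) (q p : Plane) : ℝ :=
  -hamiltonian μ q p +
    2 * (-(angularMomentum q p) ^ 2 + angularMomentum q p * p 1
      - (1 - μ) * (q 0 + 1 / 2) / dist q Primary.earth.pos
      - μ * (1 - (q 0 + 1 / 2)) / dist q Primary.moon.pos)

/-- The critical value of the Hamiltonian. -/
def criticalEnergy (μ : ℝ) : ℝ := -1 - 2 * √(μ * (1 - μ))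

/-- Hill's region `{V ≤ c}`; since `V = -∞` at the two centers, these belong to it. -/
def hillRegion (μ c : ℝ) : Set Plane :=
  {q | q = Primary.earth.pos ∨ q = Primary.moon.pos ∨ potential μ q ≤ c}

/-- The connected component of Hill's region around a center. -/
def hillComponent (μ c : ℝ) (P : Primary) : Set Plane :=
  connectedComponentIn (hillRegion μ c) P.pos

/-- Elliptic coordinates `(λ, ν)` with their conjugate momenta; the angle `ν` is lifted to `ℝ`. -/
structure PhasePoint where
  lam : ℝ
  nu : ℝ
  pLam : ℝ
  pNu : ℝ

/-- The point of the plane with elliptic coordinates `(λ, ν)`. -/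
def PhasePoint.position (z : PhasePoint) : Plane :=
  !₂[Real.cosh z.lam * Real.cos z.nu / 2, Real.sinh z.lam * Real.sin z.nu / 2]

/-- `K_λ = 2 p_λ² - 2 cosh λ - c cosh² λ`. -/
def kLam (c lam pLam : ℝ) : ℝ :=
  2 * pLam ^ 2 - 2 * Real.cosh lam - c * Real.cosh lam ^ 2

/-- `K_ν = 2 p_ν² + 2 (1-2μ) cos ν + c cos² ν`. -/
def kNu (μ c nu pNu : ℝ) : ℝ :=
  2 * pNu ^ 2 + 2 * (1 - 2 * μ) * Real.cos nu + c * Real.cos nu ^ 2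

/-- The regularized Hamiltonian `K = (cosh² λ - cos² ν) (H - c) = K_λ + K_ν`
(see `regularizedHamiltonian_eq`). -/
def regularizedHamiltonian (μ c lam nu pLam pNu : ℝ) : ℝ :=
  kLam c lam pLam + kNu μ c nu pNu

/-- `z` is an integral curve of the Hamiltonian flow of `K`. -/
structure IsTrajectory (μ c : ℝ) (z : ℝ → PhasePoint) : Prop where
  lam : ∀ t, HasDerivAt (fun s => (z s).lam)
    (deriv (fun x => regularizedHamiltonian μ c (z t).lam (z t).nu x (z t).pNu) (z t).pLam) t
  nu : ∀ t, HasDerivAt (fun s => (z s).nu)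
    (deriv (fun x => regularizedHamiltonian μ c (z t).lam (z t).nu (z t).pLam x) (z t).pNu) t
  pLam : ∀ t, HasDerivAt (fun s => (z s).pLam)
    (-deriv (fun x => regularizedHamiltonian μ c x (z t).nu (z t).pLam (z t).pNu) (z t).lam) t
  pNu : ∀ t, HasDerivAt (fun s => (z s).pNu)
    (-deriv (fun x => regularizedHamiltonian μ c (z t).lam x (z t).pLam (z t).pNu) (z t).nu) t

/-- The part around the center `P` of the regularized level set `{G = g, H = c}`. Here `H = c`
is `K = 0`, and on it `G = K_λ` (see `regularizedHamiltonian_eq`, `firstIntegral_eq`). For `(g, c)`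
in the regions `S` and `S'` this is, when not empty, a Liouville torus. -/
def liouvilleTorus (μ g c : ℝ) (P : Primary) : Set PhasePoint :=
  {z | kLam c z.lam z.pLam = g ∧ kNu μ c z.nu z.pNu = -g ∧
    z.position ∈ hillComponent μ c P}

/-- The region `S` of regular values of `(G, H)`: one torus around each center. -/
def InRegionS (μ g c : ℝ) : Prop :=
  c < criticalEnergy μ ∧ -2 < g + c ∧ g + c < -2 * |1 - 2 * μ|

/-- The region `S'` of regular values of `(G, H)`: a single torus, around the heavier center. -/
def InRegionS' (μ g c : ℝ) : Prop :=
  c < criticalEnergy μ ∧ -2 * |1 - 2 * μ| < g + c ∧ g + c < 2 * |1 - 2 * μ|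

/-- `T` is the minimal positive period of `f`. -/
def IsMinimalPeriod {α : Type*} (f : ℝ → α) (T : ℝ) : Prop :=
  0 < T ∧ Function.Periodic f T ∧ ∀ T', 0 < T' → Function.Periodic f T' → T ≤ T'

/-- The torus has rotation number `R = T_ν / T_λ`, where `T_λ`, `T_ν` are the minimal periods of
the flows of `K_λ`, `K_ν` on it. As `K = K_λ + K_ν`, these flows move the `(λ, p_λ)`-part and the
`(ν, p_ν)`-part of a trajectory; all trajectories on the torus have the same two periods, since
each part runs through a single closed phase curve. -/
def HasRotationNumber (μ g c : ℝ) (P : Primary) (R : ℝ) : Prop :=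
  ∃ (z : ℝ → PhasePoint) (Tlam Tnu : ℝ),
    IsTrajectory μ c z ∧ (∀ t, z t ∈ liouvilleTorus μ g c P) ∧
    IsMinimalPeriod (fun t => ((z t).lam, (z t).pLam)) Tlam ∧
    IsMinimalPeriod (fun t => ((z t).nu, (z t).pNu)) Tnu ∧
    R = Tnu / Tlam

/-- The torus is a `T_{k,l}`-torus. -/
def IsTorusOfType (μ g c : ℝ) (P : Primary) (k l : ℕ) : Prop :=
  0 < k ∧ 0 < l ∧ Nat.Coprime k l ∧ HasRotationNumber μ g c P ((k : ℝ) / (l : ℝ))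

/-- The orbits on the torus, as parametrized curves in the plane. -/
def torusOrbits (μ g c : ℝ) (P : Primary) : Set (ℝ → Plane) :=
  {γ | ∃ z : ℝ → PhasePoint, IsTrajectory μ c z ∧ (∀ t, z t ∈ liouvilleTorus μ g c P) ∧
    γ = fun t => (z t).position}

/-- The curve passes twice through some point, with nonzero velocities of opposite directions. -/
def HasInverseSelfTangency (γ : ℝ → Plane) : Prop :=
  ∃ t₀ t₁ a : ℝ, γ t₀ = γ t₁ ∧ deriv γ t₀ ≠ 0 ∧ 0 < a ∧ deriv γ t₁ = -(a • deriv γ t₀)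

/-- A brake-brake orbit: a periodic orbit with inverse self-tangencies that touches the boundary of
(the component around `P` of) Hill's region at two distinct points. -/
def IsBrakeBrake (μ c : ℝ) (P : Primary) (γ : ℝ → Plane) : Prop :=
  (∃ T, 0 < T ∧ Function.Periodic γ T) ∧ HasInverseSelfTangency γ ∧
    ∃ t₀ t₁, γ t₀ ∈ frontier (hillComponent μ c P) ∧ γ t₁ ∈ frontier (hillComponent μ c P) ∧
      γ t₀ ≠ γ t₁

/-- A brake-collision orbit: a periodic orbit with inverse self-tangencies that touches the boundary
of (the component around `P` of) Hill's region and collides with the center `P`. -/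
def IsBrakeCollision (μ c : ℝ) (P : Primary) (γ : ℝ → Plane) : Prop :=
  (∃ T, 0 < T ∧ Function.Periodic γ T) ∧ HasInverseSelfTangency γ ∧
    (∃ t, γ t ∈ frontier (hillComponent μ c P)) ∧ ∃ t, γ t = P.pos

/-- The brake-brake orbits on the torus. -/
def brakeBrakeOrbits (μ g c : ℝ) (P : Primary) : Set (ℝ → Plane) :=
  {γ | γ ∈ torusOrbits μ g c P ∧ IsBrakeBrake μ c P γ}

/-- The brake-collision orbits on the torus. -/
def brakeCollisionOrbits (μ g c : ℝ) (P : Primary) : Set (ℝ → Plane) :=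
  {γ | γ ∈ torusOrbits μ g c P ∧ IsBrakeCollision μ c P γ}

/-- The quadruple points of a closed curve: the points through which it passes exactly four times
during one minimal period. -/
def quadruplePoints (γ : ℝ → Plane) : Set Plane :=
  {x | ∃ T, IsMinimalPeriod γ T ∧ {t | t ∈ Set.Ico 0 T ∧ γ t = x}.encard = 4}

/-- The relation `p₁ dq₁ + p₂ dq₂ = p_λ dλ + p_ν dν` between Cartesian and elliptic momenta. -/
def IsCartesianMomentum (z : PhasePoint) (p : Plane) : Prop :=
  z.pLam = p 0 * deriv (fun x => Real.cosh x * Real.cos z.nu / 2) z.lam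
    + p 1 * deriv (fun x => Real.sinh x * Real.sin z.nu / 2) z.lam ∧
  z.pNu = p 0 * deriv (fun y => Real.cosh z.lam * Real.cos y / 2) z.nu
    + p 1 * deriv (fun y => Real.sinh z.lam * Real.sin y / 2) z.nu

theorem IsCartesianMomentum.eqs {z : PhasePoint} {p : Plane} (h : IsCartesianMomentum z p) :
    z.pLam = (p 0 * (Real.sinh z.lam * Real.cos z.nu)
      + p 1 * (Real.cosh z.lam * Real.sin z.nu)) / 2 ∧
    z.pNu = (-(p 0 * (Real.cosh z.lam * Real.sin z.nu))
      + p 1 * (Real.sinh z.lam * Real.cos z.nu)) / 2 := by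
  obtain ⟨h1, h2⟩ := h
  have d1 : deriv (fun x => Real.cosh x * Real.cos z.nu / 2) z.lam
      = Real.sinh z.lam * Real.cos z.nu / 2 :=
    (((Real.hasDerivAt_cosh z.lam).mul_const _).div_const 2).deriv
  have d2 : deriv (fun x => Real.sinh x * Real.sin z.nu / 2) z.lam
      = Real.cosh z.lam * Real.sin z.nu / 2 :=
    (((Real.hasDerivAt_sinh z.lam).mul_const _).div_const 2).deriv
  have d3 : deriv (fun y => Real.cosh z.lam * Real.cos y / 2) z.nu
      = Real.cosh z.lam * -Real.sin z.nu / 2 :=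
    (((Real.hasDerivAt_cos z.nu).const_mul _).div_const 2).deriv
  have d4 : deriv (fun y => Real.sinh z.lam * Real.sin y / 2) z.nu
      = Real.sinh z.lam * Real.cos z.nu / 2 :=
    (((Real.hasDerivAt_sin z.nu).const_mul _).div_const 2).deriv
  rw [d1, d2] at h1
  rw [d3, d4] at h2
  constructor
  · rw [h1]; ring
  · rw [h2]; ring

theorem dist_earth (z : PhasePoint) :
    dist z.position Primary.earth.pos = (Real.cosh z.lam + Real.cos z.nu) / 2 := by
  have h1 := Real.one_le_cosh z.lam
  have h2 := Real.neg_one_le_cos z.nu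
  have h3 : Real.sinh z.lam ^ 2 = Real.cosh z.lam ^ 2 - 1 := Real.sinh_sq z.lam
  have h4 : Real.sin z.nu ^ 2 = 1 - Real.cos z.nu ^ 2 := Real.sin_sq z.nu
  rw [EuclideanSpace.dist_eq,
    Real.sqrt_eq_iff_eq_sq (by positivity) (by linarith), Fin.sum_univ_two]
  simp only [Real.dist_eq, sq_abs, PhasePoint.position, Primary.pos, PiLp.toLp_apply,
    Matrix.cons_val_zero, Matrix.cons_val_one]
  linear_combination (Real.sin z.nu ^ 2 / 4) * h3 + ((Real.cosh z.lam ^ 2 - 1) / 4) * h4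

theorem dist_moon (z : PhasePoint) :
    dist z.position Primary.moon.pos = (Real.cosh z.lam - Real.cos z.nu) / 2 := by
  have h1 := Real.one_le_cosh z.lam
  have h2 := Real.cos_le_one z.nu
  have h3 : Real.sinh z.lam ^ 2 = Real.cosh z.lam ^ 2 - 1 := Real.sinh_sq z.lam
  have h4 : Real.sin z.nu ^ 2 = 1 - Real.cos z.nu ^ 2 := Real.sin_sq z.nu
  rw [EuclideanSpace.dist_eq,
    Real.sqrt_eq_iff_eq_sq (by positivity) (by linarith), Fin.sum_univ_two]
  simp only [Real.dist_eq, sq_abs, PhasePoint.position, Primary.pos, PiLp.toLp_apply,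
    Matrix.cons_val_zero, Matrix.cons_val_one]
  linear_combination (Real.sin z.nu ^ 2 / 4) * h3 + ((Real.cosh z.lam ^ 2 - 1) / 4) * h4

/-- `K = (cosh² λ - cos² ν) (H - c)` away from the collisions. -/
theorem regularizedHamiltonian_eq (μ c : ℝ) (z : PhasePoint) (p : Plane)
    (hE : z.position ≠ Primary.earth.pos) (hM : z.position ≠ Primary.moon.pos)
    (h : IsCartesianMomentum z p) :
    regularizedHamiltonian μ c z.lam z.nu z.pLam z.pNu =
      (Real.cosh z.lam ^ 2 - Real.cos z.nu ^ 2) * (hamiltonian μ z.position p - c) := by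
  obtain ⟨e1, e2⟩ := h.eqs
  have hE' := dist_ne_zero.2 hE
  have hM' := dist_ne_zero.2 hM
  rw [dist_earth] at hE'
  rw [dist_moon] at hM'
  have hE2 : Real.cosh z.lam + Real.cos z.nu ≠ 0 := fun h0 => hE' (by rw [h0]; simp)
  have hM2 : Real.cosh z.lam - Real.cos z.nu ≠ 0 := fun h0 => hM' (by rw [h0]; simp)
  have h3 : Real.sinh z.lam ^ 2 = Real.cosh z.lam ^ 2 - 1 := Real.sinh_sq z.lam
  have h4 : Real.sin z.nu ^ 2 = 1 - Real.cos z.nu ^ 2 := Real.sin_sq z.nu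
  have hn : ‖p‖ ^ 2 = p 0 ^ 2 + p 1 ^ 2 := by
    rw [EuclideanSpace.norm_sq_eq, Fin.sum_univ_two]; simp
  have hV : (Real.cosh z.lam ^ 2 - Real.cos z.nu ^ 2) * potential μ z.position =
      -2 * Real.cosh z.lam + 2 * (1 - 2 * μ) * Real.cos z.nu := by
    rw [potential, dist_earth, dist_moon]
    field_simp
    ring
  have hT : 2 * z.pLam ^ 2 + 2 * z.pNu ^ 2 =
      (Real.cosh z.lam ^ 2 - Real.cos z.nu ^ 2) * (‖p‖ ^ 2 / 2) := by
    rw [e1, e2, hn]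
    linear_combination (p 0 ^ 2 + p 1 ^ 2) / 2 *
      (Real.cos z.nu ^ 2 * h3 + Real.cosh z.lam ^ 2 * h4)
  unfold regularizedHamiltonian kLam kNu hamiltonian
  linear_combination hT - hV

/-- `G = K_λ` on the level set `H = c`, away from the collisions. -/
theorem firstIntegral_eq (μ c : ℝ) (z : PhasePoint) (p : Plane)
    (hE : z.position ≠ Primary.earth.pos) (hM : z.position ≠ Primary.moon.pos)
    (h : IsCartesianMomentum z p) (hc : hamiltonian μ z.position p = c) :
    firstIntegral μ z.position p = kLam c z.lam z.pLam := by
  obtain ⟨e1, e2⟩ := h.eqs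
  have hE' := dist_ne_zero.2 hE
  have hM' := dist_ne_zero.2 hM
  rw [dist_earth] at hE'
  rw [dist_moon] at hM'
  have hE2 : Real.cosh z.lam + Real.cos z.nu ≠ 0 := fun h0 => hE' (by rw [h0]; simp)
  have hM2 : Real.cosh z.lam - Real.cos z.nu ≠ 0 := fun h0 => hM' (by rw [h0]; simp)
  have h3 : Real.sinh z.lam ^ 2 = Real.cosh z.lam ^ 2 - 1 := Real.sinh_sq z.lam
  have h4 : Real.sin z.nu ^ 2 = 1 - Real.cos z.nu ^ 2 := Real.sin_sq z.nu
  have hn : ‖p‖ ^ 2 = p 0 ^ 2 + p 1 ^ 2 := by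
    rw [EuclideanSpace.norm_sq_eq, Fin.sum_univ_two]; simp
  have q0 : z.position 0 = Real.cosh z.lam * Real.cos z.nu / 2 := by simp [PhasePoint.position]
  have q1 : z.position 1 = Real.sinh z.lam * Real.sin z.nu / 2 := by simp [PhasePoint.position]
  have hc' : c = (p 0 ^ 2 + p 1 ^ 2) / 2 + potential μ z.position := by
    rw [← hc, hamiltonian, hn]
  have hV : potential μ z.position * (Real.cosh z.lam ^ 2 - 1)
      - 2 * ((1 - μ) * (Real.cosh z.lam * Real.cos z.nu / 2 + 1 / 2)
        / ((Real.cosh z.lam + Real.cos z.nu) / 2))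
      - 2 * (μ * (1 - (Real.cosh z.lam * Real.cos z.nu / 2 + 1 / 2))
        / ((Real.cosh z.lam - Real.cos z.nu) / 2)) = -2 * Real.cosh z.lam := by
    rw [potential, dist_earth, dist_moon]
    field_simp
    ring
  rw [firstIntegral, hc, angularMomentum, q0, q1, dist_earth, dist_moon]
  unfold kLam
  rw [e1]
  linear_combination hV + (Real.cosh z.lam ^ 2 - 1) * hc'
    - (p 1 ^ 2 * Real.cosh z.lam ^ 2 / 2 + p 0 ^ 2 * Real.sinh z.lam ^ 2 / 2) * h4
    - p 0 ^ 2 / 2 * h3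

end

end EulerProblem

/-! ### One-dimensional motion in a symmetric well. -/

namespace EulerProblem

/-! In elliptic coordinates the flow separates: `λ` and `x = ν - ν_P` oscillate independently in
even one-dimensional wells. Uniqueness for the ODE turns reflection and time reversal into
symmetries of the motion: started at its right turning point, each coordinate is an even wave that
changes sign after half a period, and it takes equal or opposite values only where this forces it
(`IsOscillation.exists_symmetricWave`). No period integral is needed, since the periods come with
the rotation number.

On the level `K = 0`, four times `hillFunction` equals minus the kinetic part, so touching the
boundary means that both momenta vanish. Hence every orbit touching the boundary is, up to a time
shift, `(Y₁, ε Y₂)` with `ε = ±1`; the other two sign choices give the same plane curves, because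
`(λ, x)` and `(-λ, -x)` are the same point (`chart_eq_iff`, `IsBrakeFrame.exists_eq_brakeCurve`).
Let `h₁, h₂` be the half periods, so that `k h₁ = l h₂`. After this time `Y₁` is multiplied by
`(-1)^k` and `Y₂` by `(-1)^l`. If `k + l` is odd, this exchanges the two curves and reaches a second
boundary point: one brake-brake orbit. If `k` and `l` are odd, the curves stay different, and at
half this time both waves vanish: two brake-collision orbits.

For quadruple points, choose a time unit in which the half periods are integers `L, K`, namely `(2l,
2k)` or `(l, k)`. Times `u, u'` give the same point iff `u' = ±u + mL` and `u' = ±u + nK`, with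
independent signs and `m ≡ n` mod 2 (`Coincide`). The minimal period is `KL`. A point is passed four
times exactly when `u` is an integer divisible by neither `L` nor `K`, and at most twice otherwise.
Inclusion-exclusion counts these integers in one period, and division by four gives both formulas
(`quadruplePoints_of_coincide`, `card_not_dvd_Ico`). -/

/-- A symmetric one-dimensional potential well: force `f = -U'`, domain `s`, energy `e`. -/
structure IsWell (f U : ℝ → ℝ) (s : Set ℝ) (e : ℝ) : Prop where
  lipschitz : ∃ K, LipschitzOnWith K f s
  force_neg : ∀ y, f (-y) = -f y
  potential_neg : ∀ y, U (-y) = U y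
  neg_mem : ∀ y ∈ s, -y ∈ s
  strictMono : ∀ x ∈ s, ∀ y ∈ s, |x| < |y| → U x < U y
  force_pos : ∀ y ∈ s, y < 0 → 0 < f y
  bottom_lt : U 0 < e

/-- A motion `y` with momentum `p` and energy `e` under the force `f = -U'`, inside `s`. -/
structure IsOscillation (f U : ℝ → ℝ) (s : Set ℝ) (e : ℝ) (y p : ℝ → ℝ) : Prop where
  pos : ∀ t, HasDerivAt y (4 * p t) t
  mom : ∀ t, HasDerivAt p (f (y t)) t
  energy : ∀ t, 2 * p t ^ 2 + U (y t) = e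
  mem : ∀ t, y t ∈ s

/-- `y` is even and changes sign under the translation by `h`, and takes equal or opposite values
only where these symmetries force it. -/
structure IsSymmetricWave (y : ℝ → ℝ) (h : ℝ) : Prop where
  pos : 0 < h
  eq_iff : ∀ u v, y u = y v ↔ ∃ m : ℤ, Even m ∧ (u = v + m * h ∨ u = -v + m * h)
  eq_neg_iff : ∀ u v, y u = -y v ↔ ∃ m : ℤ, Odd m ∧ (u = v + m * h ∨ u = -v + m * h)

section

variable {f U : ℝ → ℝ} {s : Set ℝ} {e : ℝ} {y p y' p' : ℝ → ℝ}

theorem IsOscillation.shift (h : IsOscillation f U s e y p) (a : ℝ) :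
    IsOscillation f U s e (fun t => y (a + t)) (fun t => p (a + t)) where
  pos t := by simpa using (h.pos (a + t)).comp_const_add a t
  mom t := by simpa using (h.mom (a + t)).comp_const_add a t
  energy t := h.energy _
  mem t := h.mem _

theorem IsOscillation.neg (w : IsWell f U s e) (h : IsOscillation f U s e y p) :
    IsOscillation f U s e (fun t => -y t) (fun t => -p t) where
  pos t := by simpa using (h.pos t).fun_neg
  mom t := by simpa [w.force_neg] using (h.mom t).fun_neg
  energy t := by simpa [w.potential_neg] using h.energy t
  mem t := w.neg_mem _ (h.mem t)

theorem IsOscillation.reverse (h : IsOscillation f U s e y p) :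
    IsOscillation f U s e (fun t => y (-t)) (fun t => -p (-t)) where
  pos t := by
    have := (h.pos (-t)).scomp t (hasDerivAt_neg t)
    simpa [Function.comp_def] using this
  mom t := by
    have := ((h.mom (-t)).scomp t (hasDerivAt_neg t)).fun_neg
    simpa [Function.comp_def] using this
  energy t := by simpa using h.energy (-t)
  mem t := h.mem _

/-- Picard-Lindelöf uniqueness, with a Lipschitz bound needed only on `s` because both motions stay
there. All symmetries of the waves are deduced from it. -/
theorem IsOscillation.unique (w : IsWell f U s e) (h : IsOscillation f U s e y p)
    (h' : IsOscillation f U s e y' p') {t₀ : ℝ} (hy : y t₀ = y' t₀) (hp : p t₀ = p' t₀) (t : ℝ) :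
    y t = y' t ∧ p t = p' t := by
  obtain ⟨K, hK⟩ := w.lipschitz
  have hv : LipschitzOnWith (max 4 K) (fun q : ℝ × ℝ => (4 * q.2, f q.1)) (s ×ˢ Set.univ) := by
    refine LipschitzOnWith.of_dist_le_mul fun a ha b hb => ?_
    have h1 := hK.dist_le_mul a.1 ha.1 b.1 hb.1
    have ha : dist a.1 b.1 ≤ dist a b := by rw [Prod.dist_eq]; exact le_max_left _ _
    have hb : dist a.2 b.2 ≤ dist a b := by rw [Prod.dist_eq]; exact le_max_right _ _
    have h2 : dist (4 * a.2) (4 * b.2) = 4 * dist a.2 b.2 := by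
      rw [Real.dist_eq, Real.dist_eq, ← mul_sub, abs_mul]; norm_num
    have h4 : (4 : ℝ) ≤ (max 4 K : NNReal) := by
      exact_mod_cast le_max_left (4 : NNReal) K
    have h5 : (K : ℝ) ≤ (max 4 K : NNReal) := by
      exact_mod_cast le_max_right (4 : NNReal) K
    rw [Prod.dist_eq (x := (4 * a.2, f a.1))]
    refine max_le ?_ ?_
    · change dist (4 * a.2) (4 * b.2) ≤ _
      rw [h2]
      exact mul_le_mul h4 hb dist_nonneg (by positivity)
    · exact h1.trans (mul_le_mul h5 ha dist_nonneg (by positivity))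
  have key := ODE_solution_unique_univ (v := fun (_ : ℝ) (q : ℝ × ℝ) => (4 * q.2, f q.1))
    (s := fun _ => s ×ˢ Set.univ) (f := fun t => (y t, p t)) (g := fun t => (y' t, p' t))
    (t₀ := t₀) (fun _ => hv) (fun t => ⟨(h.pos t).prodMk (h.mom t), h.mem t, trivial⟩)
    (fun t => ⟨(h'.pos t).prodMk (h'.mom t), h'.mem t, trivial⟩) (by simp [hy, hp])
  have := congrFun key t
  simpa using this

theorem IsMinimalPeriod.exists_int_mul {α : Type*} {F : ℝ → α} {T : ℝ} (h : IsMinimalPeriod F T)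
    {T' : ℝ} (h' : Function.Periodic F T') : ∃ m : ℤ, T' = m * T := by
  obtain ⟨h0, hp, hmin⟩ := h
  refine ⟨⌊T' / T⌋, ?_⟩
  have hper : Function.Periodic F (T' - ⌊T' / T⌋ * T) := by
    intro t
    have h1 := (hp.int_mul ⌊T' / T⌋).sub_eq (t + T')
    rw [← add_sub_assoc]
    rw [h1, h' t]
  have hnn : 0 ≤ T' - ⌊T' / T⌋ * T := Int.sub_floor_div_mul_nonneg _ h0
  have hlt : T' - ⌊T' / T⌋ * T < T := Int.sub_floor_div_mul_lt _ h0
  rcases hnn.eq_or_lt with h | h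
  · linarith
  · exact absurd (hmin _ h hper) (not_le.2 hlt)

/-- Take a maximum of `y` over a period. It is not `0`, as the energy lies above the bottom of the
well. If it were negative, the force would be positive at all times and `p` strictly increasing,
against periodicity. -/
theorem IsOscillation.exists_turning (w : IsWell f U s e) (h : IsOscillation f U s e y p) {T : ℝ}
    (hT : 0 < T) (hy : Function.Periodic y T) (hp : Function.Periodic p T) :
    ∃ t, p t = 0 ∧ 0 < y t := by
  have hc : Continuous y := continuous_iff_continuousAt.2 fun t => (h.pos t).continuousAt
  obtain ⟨t₀, -, hmax⟩ := isCompact_Icc.exists_isMaxOn (Set.nonempty_Icc.2 hT.le)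
    hc.continuousOn (s := Set.Icc 0 T)
  have hle : ∀ t, y t ≤ y t₀ := by
    intro t
    obtain ⟨t', ht', he⟩ := hy.exists_mem_Ico₀ hT t
    rw [he]
    exact hmax ⟨ht'.1, ht'.2.le⟩
  have hp0 : p t₀ = 0 := by
    have := IsLocalMax.hasDerivAt_eq_zero (Filter.Eventually.of_forall hle) (h.pos t₀)
    linarith
  refine ⟨t₀, hp0, ?_⟩
  by_contra hneg
  have hne : y t₀ ≠ 0 := by
    intro h0
    have := h.energy t₀
    rw [hp0, h0] at this
    have := w.bottom_lt
    linarith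
  have hlt : y t₀ < 0 := lt_of_le_of_ne (not_lt.1 hneg) hne
  have hsm : StrictMono p := strictMono_of_hasDerivAt_pos h.mom
    (fun t => w.force_pos _ (h.mem t) ((hle t).trans_lt hlt))
  have := hsm hT
  have h2 := hp 0
  rw [zero_add] at h2
  linarith

theorem IsWell.abs_eq_of_potential_eq (w : IsWell f U s e) {a b : ℝ} (ha : a ∈ s) (hb : b ∈ s)
    (h : U a = U b) : |a| = |b| := by
  rcases lt_trichotomy |a| |b| with h1 | h1 | h1
  · have := w.strictMono a ha b hb h1; linarith
  · exact h1
  · have := w.strictMono b hb a ha h1; linarith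

/-- A periodic motion in a symmetric well, started at its right turning point, is a symmetric wave;
any other motion with a rest point is this one up to sign and time shift. -/
theorem IsOscillation.exists_symmetricWave (w : IsWell f U s e) (h : IsOscillation f U s e y p)
    {T : ℝ} (hT : IsMinimalPeriod (fun t => (y t, p t)) T) :
    ∃ Y Q, IsOscillation f U s e Y Q ∧ IsSymmetricWave Y (T / 2) ∧ Q 0 = 0 ∧
      ∀ y' p', IsOscillation f U s e y' p' → ∀ t₀, p' t₀ = 0 →
        (∀ t, y' (t₀ + t) = Y t) ∨ (∀ t, y' (t₀ + t) = -Y t) := by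
  have hyT : Function.Periodic y T := fun t => (Prod.ext_iff.1 (hT.2.1 t)).1
  have hpT : Function.Periodic p T := fun t => (Prod.ext_iff.1 (hT.2.1 t)).2
  obtain ⟨t₀, hp0, hy0⟩ := h.exists_turning w hT.1 hyT hpT
  obtain ⟨t₁, hp1, hy1⟩ := (h.neg w).exists_turning w hT.1 (fun t => by simp [hyT t])
    (fun t => by simp [hpT t])
  have hO := h.shift t₀
  set Y : ℝ → ℝ := fun t => y (t₀ + t) with hY
  set Q : ℝ → ℝ := fun t => p (t₀ + t) with hQ
  have hQ0 : Q 0 = 0 := by simpa [hQ] using hp0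
  have hY0 : 0 < Y 0 := by simpa [hY] using hy0
  -- The potential is strictly monotone in `|y|`, so the level `e` has only two rest positions, `±Y
  -- 0`.
  have habs : ∀ a ∈ s, U a = e → a = Y 0 ∨ a = -Y 0 := by
    intro a ha hU
    have h1 := hO.energy 0
    rw [hQ0] at h1
    exact abs_eq_abs.1 (w.abs_eq_of_potential_eq ha (hO.mem 0) (by linarith))
  have huniq : ∀ y' p', IsOscillation f U s e y' p' → ∀ t₀, p' t₀ = 0 →
      (∀ t, y' (t₀ + t) = Y t) ∨ (∀ t, y' (t₀ + t) = -Y t) := by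
    intro y' p' h' a ha
    have h1 := h'.energy a
    rw [ha] at h1
    rcases habs _ (h'.mem a) (by linarith) with h2 | h2
    · left
      intro t
      exact ((h'.shift a).unique w hO (t₀ := 0) (by simpa using h2) (by simpa [hQ0] using ha) t).1
    · right
      intro t
      exact ((h'.shift a).unique w (hO.neg w) (t₀ := 0) (by simpa using h2)
        (by simpa [hQ0] using ha) t).1
  have hrev : ∀ t, Y (-t) = Y t ∧ -Q (-t) = Q t := fun t =>
    hO.reverse.unique w hO (t₀ := 0) (by simp) (by simp [hQ0]) t
  have hper : ∀ a b, Y a = Y b → Q a = Q b → ∃ m : ℤ, a = b + m * T := by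
    intro a b h1 h2
    have h3 : Function.Periodic (fun t => (y t, p t)) (a - b) := by
      intro t
      have := (hO.shift a).unique w (hO.shift b) (t₀ := 0) (by simpa using h1) (by simpa using h2)
        (t - t₀ - b)
      simp only [hY, hQ] at this
      have e1 : t₀ + (a + (t - t₀ - b)) = t + (a - b) := by ring
      have e2 : t₀ + (b + (t - t₀ - b)) = t := by ring
      rw [e1, e2] at this
      exact Prod.ext this.1 this.2
    obtain ⟨m, hm⟩ := hT.exists_int_mul h3
    exact ⟨m, by linarith⟩
  have hYm : ∀ (m : ℤ) t, Y (t + m * T) = Y t := by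
    intro m t
    have := hyT.int_mul m (t₀ + t)
    simp only [hY]
    rw [← add_assoc]
    exact this
  have heq : ∀ u v, Y u = Y v ↔ ∃ m : ℤ, u = v + m * T ∨ u = -v + m * T := by
    intro u v
    constructor
    · intro huv
      have h1 := hO.energy u
      have h2 := hO.energy v
      rw [huv] at h1
      have h3 : Q u ^ 2 = Q v ^ 2 := by linarith
      rcases sq_eq_sq_iff_eq_or_eq_neg.1 h3 with h4 | h4
      · obtain ⟨m, hm⟩ := hper u v huv h4
        exact ⟨m, Or.inl hm⟩
      · obtain ⟨m, hm⟩ := hper u (-v) (by rw [huv, (hrev v).1]) (by rw [h4, ← (hrev v).2, neg_neg])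
        exact ⟨m, Or.inr hm⟩
    · rintro ⟨m, rfl | rfl⟩
      · exact hYm m v
      · rw [hYm, (hrev v).1]
  have hhalf : ∀ t, Y (t + T / 2) = -Y t := by
    have hp1' : p t₁ = 0 := by simpa using hp1
    -- At the left turning point `t₁` the alternative with the plus sign would give `y t₁ = Y 0 >
    -- 0`.
    have hneg : ∀ t, Y ((t₁ - t₀) + t) = -Y t := by
      have hy1' : y t₁ < 0 := by linarith
      rcases huniq y p h t₁ hp1' with h1 | h1
      · have := h1 0
        rw [add_zero] at this
        linarith
      · intro t
        rw [← h1 t]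
        simp only [hY]
        congr 1
        ring
    -- Flipping the sign twice is the identity, so `t₁ - t₀` is a multiple of `T / 2`; an even
    -- multiple would be a period and could not flip the sign.
    obtain ⟨m, hm⟩ := (heq ((t₁ - t₀) + (t₁ - t₀)) 0).1 (by
      rw [hneg, ← add_zero (t₁ - t₀), hneg, neg_neg])
    have hm' : t₁ - t₀ = m * T / 2 := by
      rcases hm with hm | hm <;> linarith
    intro t
    rcases Int.even_or_odd' m with ⟨n, rfl | rfl⟩
    · exfalso
      have h1 := hneg 0
      have h2 := hYm n 0
      push_cast at hm'
      have e1 : t₁ - t₀ + 0 = 0 + n * T := by rw [hm']; ring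
      rw [e1, h2] at h1
      linarith
    · rw [← hneg t, hm', ← hYm n (t + T / 2)]
      push_cast
      congr 1
      ring
  have hmul : ∀ (m : ℤ) (t : ℝ), (Even m → Y (t + m * (T / 2)) = Y t) ∧
      (Odd m → Y (t + m * (T / 2)) = -Y t) := by
    intro m t
    constructor
    · rintro ⟨n, rfl⟩
      rw [← hYm n t]
      push_cast
      congr 1
      ring
    · rintro ⟨n, rfl⟩
      rw [← hhalf t, ← hYm n (t + T / 2)]
      push_cast
      congr 1
      ring
  have heq2 : ∀ u v, Y u = Y v ↔
      ∃ m : ℤ, Even m ∧ (u = v + m * (T / 2) ∨ u = -v + m * (T / 2)) := by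
    intro u v
    constructor
    · intro huv
      obtain ⟨m, hm⟩ := (heq u v).1 huv
      refine ⟨2 * m, even_two_mul m, ?_⟩
      push_cast
      rcases hm with hm | hm
      · left; rw [hm]; ring
      · right; rw [hm]; ring
    · rintro ⟨m, hm, rfl | rfl⟩
      · exact (hmul m v).1 hm
      · rw [(hmul m _).1 hm, (hrev v).1]
  refine ⟨Y, Q, hO, ⟨half_pos hT.1, heq2, ?_⟩, hQ0, huniq⟩
  intro u v
  rw [← hhalf v, heq2]
  constructor
  · rintro ⟨m, hm, rfl | rfl⟩
    · exact ⟨m + 1, hm.add_one, Or.inl (by push_cast; ring)⟩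
    · exact ⟨m - 1, hm.sub_odd odd_one, Or.inr (by push_cast; ring)⟩
  · rintro ⟨m, hm, rfl | rfl⟩
    · exact ⟨m - 1, hm.sub_odd odd_one, Or.inl (by push_cast; ring)⟩
    · exact ⟨m + 1, hm.add_one, Or.inr (by push_cast; ring)⟩

end

end EulerProblem

/-! ### Arithmetic of coincidences between two waves with integer half periods. -/

namespace EulerProblem

theorem IsMinimalPeriod.unique {α : Type*} {F : ℝ → α} {T T' : ℝ} (h : IsMinimalPeriod F T)
    (h' : IsMinimalPeriod F T') : T = T' :=
  le_antisymm (h.2.2 _ h'.1 h'.2.1) (h'.2.2 _ h.1 h.2.1)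

/-- The arithmetic of the half periods `L`, `K` of two waves, with pairs of half periods of equal
parity acting as symmetries of the product. -/
structure IsHalfPeriodPair (L K : ℤ) : Prop where
  pos_left : 0 < L
  pos_right : 0 < K
  even_sub : Even (K - L)
  dvd_of_mul_eq : ∀ m n : ℤ, Even (m - n) → m * L = n * K → K ∣ m
  exists_sub_eq : ∀ j : ℤ, ∃ m n : ℤ, Even (m - n) ∧ 2 * j = n * K - m * L
  dvd_of_two_mul_eq : ∀ j r : ℤ, 2 * j = r * (K * L) → L ∣ j ∧ K ∣ j

/-- Here `k - l` is odd, so equal parity in `m = kr`, `n = lr` forces `r` even. Doubling both half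
periods absorbs this factor and makes every integer a solution `j = nk - ml`. -/
theorem isHalfPeriodPair_of_odd_add {k l : ℕ} (hk : 0 < k) (hl : 0 < l) (hkl : Nat.Coprime k l)
    (ho : Odd (k + l)) : IsHalfPeriodPair (2 * l) (2 * k) := by
  have hkl' : IsCoprime (k : ℤ) (l : ℤ) := Nat.isCoprime_iff_coprime.2 hkl
  have ho' : Odd ((k : ℤ) + l) := by exact_mod_cast ho
  refine ⟨by positivity, by positivity, ⟨k - l, by ring⟩, ?_, ?_, ?_⟩
  · intro m n hmn h
    have h1 : m * l = n * k := by linarith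
    obtain ⟨r, rfl⟩ : (k : ℤ) ∣ m := hkl'.dvd_of_dvd_mul_right (Dvd.intro_left n h1.symm)
    have hk0 : (k : ℤ) ≠ 0 := by positivity
    have h2 : n = l * r := by
      apply mul_right_cancel₀ hk0
      rw [← h1]; ring
    have h3 : Even r := by
      rw [h2, ← sub_mul, Int.even_mul] at hmn
      rcases hmn with h | h
      · exact absurd h (by rw [Int.not_even_iff_odd]; simpa [parity_simps] using ho')
      · exact h
    obtain ⟨q, rfl⟩ := h3
    exact ⟨q, by ring⟩
  · intro j
    obtain ⟨a, b, hab⟩ := hkl'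
    rcases Int.even_or_odd ((-(j * b)) - j * a) with h | h
    · exact ⟨-(j * b), j * a, h, by linear_combination (-2 * j) * hab⟩
    -- Adding `(k, l)` to the Bézout solution keeps `nk - ml` and changes the parity of `m - n`.
    · refine ⟨-(j * b) + k, j * a + l, ?_, by linear_combination (-2 * j) * hab⟩
      have h2 : Odd ((k : ℤ) - l) := by simpa [parity_simps] using ho'
      have := h.add_odd h2
      have e : -(j * b) + (k : ℤ) - (j * a + l) = -(j * b) - j * a + (k - l) := by ring
      rw [e]
      exact this
  · intro j r h
    have h1 : j = 2 * r * k * l := by linarith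
    exact ⟨⟨r * k, by rw [h1]; ring⟩, ⟨r * l, by rw [h1]; ring⟩⟩

theorem isHalfPeriodPair_of_even_add {k l : ℕ} (hk : 0 < k) (hl : 0 < l) (hkl : Nat.Coprime k l)
    (ho : Even (k + l)) : IsHalfPeriodPair l k ∧ Odd k ∧ Odd l := by
  have hkl' : IsCoprime (k : ℤ) (l : ℤ) := Nat.isCoprime_iff_coprime.2 hkl
  have hko : Odd k := by
    by_contra h
    rw [Nat.not_odd_iff_even] at h
    have hl2 : Even l := (Nat.even_add.1 ho).1 h
    have := Nat.dvd_gcd h.two_dvd hl2.two_dvd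
    rw [hkl] at this
    omega
  have hlo : Odd l := by
    rw [← Nat.not_even_iff_odd] at hko ⊢
    exact fun h => hko ((Nat.even_add.1 ho).2 h)
  have hko' : Odd (k : ℤ) := by exact_mod_cast hko
  have hlo' : Odd (l : ℤ) := by exact_mod_cast hlo
  refine ⟨⟨by positivity, by positivity, hko'.sub_odd hlo', ?_, ?_, ?_⟩, hko, hlo⟩
  · intro m n _ h
    exact hkl'.dvd_of_dvd_mul_right (Dvd.intro_left n h.symm)
  · intro j
    obtain ⟨a, b, hab⟩ := hkl'
    exact ⟨2 * (-(j * b)), 2 * (j * a), ⟨-(j * b) - j * a, by ring⟩,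
      by linear_combination (-2 * j) * hab⟩
  · intro j r h
    have h1 : Even (r * (k * l)) := ⟨j, by linarith⟩
    have h2 : Even r := by
      rcases Int.even_mul.1 h1 with h | h
      · exact h
      · exact absurd h (Int.not_even_iff_odd.2 (hko'.mul hlo'))
    obtain ⟨q, rfl⟩ := h2
    have h3 : j = q * (k * l) := by linarith
    exact ⟨⟨q * k, by rw [h3]; ring⟩, ⟨q * l, by rw [h3]; ring⟩⟩

/-- Coincidence of two parameters of a curve whose two coordinates are waves with half periods
`L` and `K`, modulo simultaneous change of sign. -/
def Coincide (L K u' u : ℝ) : Prop :=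
  ∃ m n : ℤ, Even (m - n) ∧ (u' = u + m * L ∨ u' = -u + m * L) ∧
    (u' = u + n * K ∨ u' = -u + n * K)

section

variable {L K : ℤ}

theorem IsHalfPeriodPair.exists_mul (h : IsHalfPeriodPair L K) {m n : ℤ} (hmn : Even (m - n))
    (he : (m : ℝ) * L = n * K) : ∃ r : ℤ, (m : ℝ) * L = r * (K * L) := by
  obtain ⟨r, rfl⟩ := h.dvd_of_mul_eq m n hmn (by exact_mod_cast he)
  exact ⟨r, by push_cast; ring⟩

/-- Equal signs leave only a common translation, a multiple of `KL`. Mixed signs give `2u = nK -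
mL`, possible only for integral `u`; if `u` is a multiple of `L` or `K`, reflection and translation
agree for that wave and the signs can be made equal. -/
theorem Coincide.of_special (h : IsHalfPeriodPair L K) {u' u : ℝ} (hc : Coincide L K u' u)
    (hu : (∀ j : ℤ, u ≠ j) ∨ (∃ a : ℤ, u = a * L) ∨ ∃ a : ℤ, u = a * K) :
    ∃ r : ℤ, u' = u + r * (K * L) ∨ u' = -u + r * (K * L) := by
  obtain ⟨m, n, hmn, h1, h2⟩ := hc
  have hint : ∀ m n : ℤ, Even (m - n) → 2 * u = n * K - m * L → ∃ j : ℤ, u = j := by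
    intro m n hmn he
    obtain ⟨a, ha⟩ := hmn
    obtain ⟨b, hb⟩ := h.even_sub
    -- With `m = n + 2a` and `K = L + 2b`, the right-hand side `nK - mL` is twice this integer.
    refine ⟨n * b - a * L, ?_⟩
    have e1 : (m : ℝ) = n + (a + a) := by exact_mod_cast (by linarith : m = n + (a + a))
    have e2 : (K : ℝ) = L + (b + b) := by exact_mod_cast (by linarith : K = L + (b + b))
    rw [e1, e2] at he
    push_cast
    linarith
  rcases h1 with h1 | h1 <;> rcases h2 with h2 | h2
  · obtain ⟨r, hr⟩ := h.exists_mul hmn (by linarith)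
    exact ⟨r, Or.inl (by rw [h1, hr])⟩
  · rcases hu with hu | ⟨a, ha⟩ | ⟨a, ha⟩
    · obtain ⟨j, hj⟩ := hint m n hmn (by linarith)
      exact absurd hj (hu j)
    · obtain ⟨r, hr⟩ := h.exists_mul (m := 2 * a + m) (n := n) (by
        rw [add_sub_assoc]; exact (even_two_mul a).add hmn) (by push_cast; linarith)
      push_cast at hr
      exact ⟨r, Or.inr (by linarith)⟩
    · obtain ⟨r, hr⟩ := h.exists_mul (m := m) (n := n - 2 * a) (by
        rw [← sub_add]; exact hmn.add (even_two_mul a)) (by push_cast; linarith)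
      exact ⟨r, Or.inl (by linarith)⟩
  · rcases hu with hu | ⟨a, ha⟩ | ⟨a, ha⟩
    · obtain ⟨j, hj⟩ := hint (-m) (-n) (by
        have e : -m - -n = -(m - n) := by ring
        rw [e]; exact hmn.neg) (by push_cast; linarith)
      exact absurd hj (hu j)
    · obtain ⟨r, hr⟩ := h.exists_mul (m := m - 2 * a) (n := n) (by
        rw [sub_right_comm]; exact hmn.sub (even_two_mul a)) (by push_cast; linarith)
      push_cast at hr
      exact ⟨r, Or.inl (by linarith)⟩
    · obtain ⟨r, hr⟩ := h.exists_mul (m := m) (n := n + 2 * a) (by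
        rw [← sub_sub]; exact hmn.sub (even_two_mul a)) (by push_cast; linarith)
      exact ⟨r, Or.inr (by linarith)⟩
  · obtain ⟨r, hr⟩ := h.exists_mul hmn (by linarith)
    exact ⟨r, Or.inr (by rw [h1, hr])⟩

/-- The relation on `j` says `j + mL = -j + nK`: a translation for the first wave that is a
reflection for the second. Any other mixed coincidence differs from this one, or from its negative,
by a multiple of `KL`. -/
theorem coincide_iff (h : IsHalfPeriodPair L K) {m n : ℤ} (hmn : Even (m - n)) {j : ℝ}
    (hj : 2 * j = n * K - m * L) {u' : ℝ} :
    Coincide L K u' j ↔ ∃ r : ℤ, u' = j + r * (K * L) ∨ u' = -j + r * (K * L) ∨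
      u' = (j + m * L) + r * (K * L) ∨ u' = -(j + m * L) + r * (K * L) := by
  constructor
  · rintro ⟨m', n', hmn', h1, h2⟩
    rcases h1 with h1 | h1 <;> rcases h2 with h2 | h2
    · obtain ⟨r, hr⟩ := h.exists_mul hmn' (by linarith)
      exact ⟨r, Or.inl (by linarith)⟩
    · obtain ⟨r, hr⟩ := h.exists_mul (m := m' - m) (n := n' - n) (by
        have e : m' - m - (n' - n) = (m' - n') - (m - n) := by ring
        rw [e]; exact hmn'.sub hmn) (by push_cast; linarith)
      push_cast at hr
      exact ⟨r, Or.inr (Or.inr (Or.inl (by linarith)))⟩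
    · obtain ⟨r, hr⟩ := h.exists_mul (m := m' + m) (n := n' + n) (by
        have e : m' + m - (n' + n) = (m' - n') + (m - n) := by ring
        rw [e]; exact hmn'.add hmn) (by push_cast; linarith)
      push_cast at hr
      exact ⟨r, Or.inr (Or.inr (Or.inr (by linarith)))⟩
    · obtain ⟨r, hr⟩ := h.exists_mul hmn' (by linarith)
      exact ⟨r, Or.inr (Or.inl (by linarith))⟩
  · rintro ⟨r, hr⟩
    have e0 : Even (r * K - r * L) := by rw [← mul_sub]; exact h.even_sub.mul_left r
    rcases hr with hr | hr | hr | hr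
    · exact ⟨r * K, r * L, e0, Or.inl (by push_cast; linarith), Or.inl (by push_cast; linarith)⟩
    · exact ⟨r * K, r * L, e0, Or.inr (by push_cast; linarith), Or.inr (by push_cast; linarith)⟩
    · refine ⟨r * K + m, r * L + n, ?_, Or.inl (by push_cast; linarith),
        Or.inr (by push_cast; linarith)⟩
      have e : r * K + m - (r * L + n) = (r * K - r * L) + (m - n) := by ring
      rw [e]; exact e0.add hmn
    · refine ⟨r * K - m, r * L - n, ?_, Or.inr (by push_cast; linarith),
        Or.inl (by push_cast; linarith)⟩
      have e : r * K - m - (r * L - n) = (r * K - r * L) - (m - n) := by ring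
      rw [e]; exact e0.sub hmn

/-- The differences of the classes `±j`, `±(j + mL)` modulo `KL`, up to sign; if one vanished, `L`
or `K` would divide `j`. -/
theorem IsHalfPeriodPair.mod_ne (h : IsHalfPeriodPair L K) {m n j : ℤ} (hmn : Even (m - n))
    (hj : 2 * j = n * K - m * L) (hL : ¬ L ∣ j) (hK : ¬ K ∣ j) (r : ℤ) :
    2 * j ≠ r * (K * L) ∧ 2 * (j + m * L) ≠ r * (K * L) ∧ m * L ≠ r * (K * L) ∧
      n * K ≠ r * (K * L) := by
  have hL0 := h.pos_left.ne'
  have hK0 := h.pos_right.ne'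
  obtain ⟨a, ha⟩ := hmn
  obtain ⟨b, hb⟩ := h.even_sub
  refine ⟨fun e => hL (h.dvd_of_two_mul_eq j r e).1, fun e => hL ?_, fun e => hK ?_, fun e => hL ?_⟩
  · have h1 := (h.dvd_of_two_mul_eq _ r e).1
    exact (Int.dvd_add_left (Dvd.intro_left m rfl)).1 h1
  · have e1 : m = r * K := mul_right_cancel₀ hL0 (by rw [e]; ring)
    refine ⟨r * b - a, ?_⟩
    have e2 : n = r * K - (a + a) := by linarith
    have e3 : L = K - (b + b) := by linarith
    rw [e1, e2, e3] at hj
    linarith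
  · have e1 : n = r * L := mul_right_cancel₀ hK0 (by rw [e]; ring)
    refine ⟨r * b - a, ?_⟩
    have e2 : m = r * L + (a + a) := by linarith
    have e3 : K = L + (b + b) := by linarith
    rw [e1, e2, e3] at hj
    linarith

theorem encard_fiber_le_two (h : IsHalfPeriodPair L K) {α : Type*} {F : ℝ → α}
    (hF : ∀ u' u, F u' = F u ↔ Coincide L K u' u) {u : ℝ}
    (hu : (∀ j : ℤ, u ≠ j) ∨ (∃ a : ℤ, u = a * L) ∨ ∃ a : ℤ, u = a * K) :
    {t | t ∈ Set.Ico (0 : ℝ) (K * L) ∧ F t = F u}.encard ≤ 2 := by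
  have hD : (0 : ℝ) < K * L := by exact_mod_cast mul_pos h.pos_right h.pos_left
  have hsub : {t | t ∈ Set.Ico (0 : ℝ) (K * L) ∧ F t = F u} ⊆
      {toIcoMod hD 0 u, toIcoMod hD 0 (-u)} := by
    rintro t ⟨ht, he⟩
    obtain ⟨r, hr | hr⟩ := ((hF _ _).1 he).of_special h hu
    · left
      exact ((toIcoMod_eq_iff hD).2 ⟨by simpa using ht, -r, by simp [hr]⟩).symm
    · right
      exact ((toIcoMod_eq_iff hD).2 ⟨by simpa using ht, -r, by simp [hr]⟩).symm
  exact (Set.encard_le_encard hsub).trans (by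
    refine (Set.encard_insert_le _ _).trans ?_
    rw [Set.encard_singleton]
    norm_num)

theorem encard_fiber_eq_four (h : IsHalfPeriodPair L K) {α : Type*} {F : ℝ → α}
    (hF : ∀ u' u, F u' = F u ↔ Coincide L K u' u) {j : ℤ} (hL : ¬ L ∣ j) (hK : ¬ K ∣ j) :
    {t | t ∈ Set.Ico (0 : ℝ) (K * L) ∧ F t = F j}.encard = 4 := by
  obtain ⟨m, n, hmn, hj⟩ := h.exists_sub_eq j
  have hD : (0 : ℤ) < K * L := mul_pos h.pos_right h.pos_left
  have hjR : 2 * (j : ℝ) = n * K - m * L := by exact_mod_cast hj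
  set S : Finset ℤ := {j % (K * L), (-j) % (K * L), (j + m * L) % (K * L), (-(j + m * L)) % (K * L)}
    with hS
  have hmod : ∀ a b : ℤ, a % (K * L) = b % (K * L) → ∃ r, a - b = r * (K * L) := by
    intro a b hab
    obtain ⟨r, hr⟩ := Int.ModEq.dvd (show b ≡ a [ZMOD K * L] from hab.symm)
    exact ⟨r, by rw [hr]; ring⟩
  have hcard : S.card = 4 := by
    have hne := h.mod_ne hmn hj hL hK
    rw [hS, Finset.card_insert_of_notMem, Finset.card_insert_of_notMem,
      Finset.card_insert_of_notMem, Finset.card_singleton]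
    · rw [Finset.mem_singleton]
      intro e
      obtain ⟨r, hr⟩ := hmod _ _ e
      exact (hne r).2.1 (by linarith)
    · simp only [Finset.mem_insert, Finset.mem_singleton]
      rintro (e | e) <;> obtain ⟨r, hr⟩ := hmod _ _ e
      · exact (hne (-r)).2.2.2 (by linarith)
      · exact (hne r).2.2.1 (by linarith)
    · simp only [Finset.mem_insert, Finset.mem_singleton]
      rintro (e | e | e) <;> obtain ⟨r, hr⟩ := hmod _ _ e
      · exact (hne r).1 (by linarith)
      · exact (hne (-r)).2.2.1 (by linarith)
      · exact (hne r).2.2.2 (by linarith)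
  have himg : {t | t ∈ Set.Ico (0 : ℝ) (K * L) ∧ F t = F j} = (fun i : ℤ => (i : ℝ)) '' S := by
    ext t
    simp only [Set.mem_ofPred_eq, hF, coincide_iff h hmn hjR, Set.mem_image, Finset.mem_coe]
    constructor
    · rintro ⟨ht, r, hr⟩
      have key : ∀ a : ℤ, t = a + r * (K * L) → t = ((a % (K * L) : ℤ) : ℝ) := by
        intro a ha
        have e1 : t = ((a + r * (K * L) : ℤ) : ℝ) := by push_cast; exact ha
        rw [e1] at ht ⊢
        have h0 : 0 ≤ a + r * (K * L) := by exact_mod_cast ht.1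
        have h1 : a + r * (K * L) < K * L := by exact_mod_cast ht.2
        rw [← Int.emod_eq_of_lt h0 h1, Int.add_mul_emod_self_right]
      rcases hr with hr | hr | hr | hr
      · exact ⟨_, by simp [hS], (key j hr).symm⟩
      · exact ⟨_, by simp [hS], (key (-j) (by push_cast; exact hr)).symm⟩
      · exact ⟨_, by simp [hS], (key (j + m * L) (by push_cast; exact hr)).symm⟩
      · exact ⟨_, by simp [hS], (key (-(j + m * L)) (by push_cast; exact hr)).symm⟩
    · rintro ⟨i, hi, rfl⟩
      have key : ∀ a : ℤ, ((a % (K * L) : ℤ) : ℝ) ∈ Set.Ico (0 : ℝ) (K * L) ∧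
          ((a % (K * L) : ℤ) : ℝ) = a + ((-(a / (K * L)) : ℤ) : ℝ) * (K * L) := by
        intro a
        refine ⟨⟨by exact_mod_cast Int.emod_nonneg a hD.ne',
          by exact_mod_cast Int.emod_lt_of_pos a hD⟩, ?_⟩
        have := Int.emod_def a (K * L)
        exact_mod_cast (by rw [this]; ring : a % (K * L) = a + (-(a / (K * L))) * (K * L))
      simp only [hS, Finset.mem_insert, Finset.mem_singleton] at hi
      rcases hi with rfl | rfl | rfl | rfl
      · exact ⟨(key _).1, _, Or.inl (key _).2⟩
      · exact ⟨(key _).1, -((-j) / (K * L)), Or.inr (Or.inl (by rw [(key _).2]; push_cast; ring))⟩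
      · exact ⟨(key _).1, -((j + m * L) / (K * L)), Or.inr (Or.inr (Or.inl (by rw [(key _).2]; push_cast; ring)))⟩
      · exact ⟨(key _).1, -(-(j + m * L) / (K * L)), Or.inr (Or.inr (Or.inr (by rw [(key _).2]; push_cast; ring)))⟩
  rw [himg, (Int.cast_injective).encard_image, Set.encard_coe_eq_coe_finsetCard, hcard]
  rfl

theorem isMinimalPeriod_of_coincide (h : IsHalfPeriodPair L K) {α : Type*} {F : ℝ → α}
    (hF : ∀ u' u, F u' = F u ↔ Coincide L K u' u) : IsMinimalPeriod F (K * L) := by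
  have hD : (0 : ℝ) < K * L := by exact_mod_cast mul_pos h.pos_right h.pos_left
  refine ⟨hD, fun t => (hF _ _).2 ⟨K, L, h.even_sub, Or.inl rfl, Or.inl (by ring)⟩, ?_⟩
  intro T' hT' hp
  -- A period coincides with the time `0`, which is a multiple of `L`, so only multiples of `KL` are
  -- possible.
  obtain ⟨r, hr⟩ := ((hF T' 0).1 (by simpa using hp 0)).of_special h
    (Or.inr (Or.inl ⟨0, by simp⟩))
  have hr' : T' = r * (K * L) := by rcases hr with hr | hr <;> simpa using hr
  have : 0 < r := by
    by_contra hneg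
    have : (r : ℝ) ≤ 0 := by exact_mod_cast not_lt.1 hneg
    nlinarith
  have : (1 : ℝ) ≤ r := by exact_mod_cast this
  nlinarith

-- The integer times divisible by neither half period map four-to-one onto the quadruple points.
open Classical in
theorem quadruplePoints_of_coincide (h : IsHalfPeriodPair L K) {F : ℝ → Plane}
    (hF : ∀ u' u, F u' = F u ↔ Coincide L K u' u) :
    (quadruplePoints F).Finite ∧ 4 * (quadruplePoints F).ncard =
      ((Finset.Ico 0 (K * L)).filter fun j => ¬ L ∣ j ∧ ¬ K ∣ j).card := by
  set Q := (Finset.Ico 0 (K * L)).filter fun j => ¬ L ∣ j ∧ ¬ K ∣ j with hQ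
  have hmin := isMinimalPeriod_of_coincide h hF
  have hint : ∀ t ∈ Set.Ico (0 : ℝ) (K * L),
      {t' | t' ∈ Set.Ico (0 : ℝ) (K * L) ∧ F t' = F t}.encard = 4 → ∃ j ∈ Q, (j : ℝ) = t := by
    intro t ht h4
    have hns : ¬ ((∀ j : ℤ, t ≠ j) ∨ (∃ a : ℤ, t = a * L) ∨ ∃ a : ℤ, t = a * K) := by
      intro hs
      have := encard_fiber_le_two h hF hs
      rw [h4] at this
      exact absurd this (by decide)
    push Not at hns
    obtain ⟨⟨j, rfl⟩, h1, h2⟩ := hns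
    refine ⟨j, ?_, rfl⟩
    rw [hQ, Finset.mem_filter, Finset.mem_Ico]
    refine ⟨⟨by exact_mod_cast ht.1, by exact_mod_cast ht.2⟩, ?_, ?_⟩
    · rintro ⟨a, rfl⟩
      exact h1 a (by push_cast; ring)
    · rintro ⟨a, rfl⟩
      exact h2 a (by push_cast; ring)
  have hfour : ∀ j ∈ Q, {t' | t' ∈ Set.Ico (0 : ℝ) (K * L) ∧ F t' = F j}.encard = 4 := by
    intro j hj
    rw [hQ, Finset.mem_filter] at hj
    exact encard_fiber_eq_four h hF hj.2.1 hj.2.2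
  have hmem : ∀ j ∈ Q, (j : ℝ) ∈ Set.Ico (0 : ℝ) (K * L) := by
    intro j hj
    rw [hQ, Finset.mem_filter, Finset.mem_Ico] at hj
    exact ⟨by exact_mod_cast hj.1.1, by exact_mod_cast hj.1.2⟩
  have hset : quadruplePoints F = (Q.image fun j : ℤ => F j : Finset Plane) := by
    ext x
    simp only [quadruplePoints, Set.mem_ofPred_eq, Finset.coe_image, Set.mem_image, Finset.mem_coe]
    constructor
    · rintro ⟨T, hT, h4⟩
      rw [hT.unique hmin] at h4
      obtain ⟨t, ht, rfl⟩ : {t | t ∈ Set.Ico (0 : ℝ) (K * L) ∧ F t = x}.Nonempty := by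
        rw [← Set.encard_ne_zero, h4]; decide
      obtain ⟨j, hj, rfl⟩ := hint t ht h4
      exact ⟨j, hj, rfl⟩
    · rintro ⟨j, hj, rfl⟩
      exact ⟨_, hmin, hfour j hj⟩
  refine ⟨by rw [hset]; exact Finset.finite_toSet _, ?_⟩
  rw [hset, Set.ncard_coe_finset, Finset.card_eq_sum_card_image (fun j : ℤ => F j) Q,
    Finset.sum_const_nat (m := 4), mul_comm]
  intro x hx
  obtain ⟨j, hj, rfl⟩ := Finset.mem_image.1 hx
  have himg : {t' | t' ∈ Set.Ico (0 : ℝ) (K * L) ∧ F t' = F j} =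
      (fun i : ℤ => (i : ℝ)) '' (Q.filter fun i : ℤ => F i = F j : Finset ℤ) := by
    ext t
    simp only [Set.mem_ofPred_eq, Set.mem_image, Finset.mem_coe, Finset.mem_filter]
    constructor
    · rintro ⟨ht, he⟩
      obtain ⟨i, hi, rfl⟩ := hint t ht (by rw [he]; exact hfour j hj)
      exact ⟨i, ⟨hi, he⟩, rfl⟩
    · rintro ⟨i, ⟨hi, he⟩, rfl⟩
      exact ⟨hmem i hi, he⟩
  have h4 := hfour j hj
  rw [himg, (Int.cast_injective).encard_image, Set.encard_coe_eq_coe_finsetCard] at h4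
  exact_mod_cast h4

end

theorem card_multiples_Ico {a b : ℤ} (ha : 0 < a) (hb : 0 < b) :
    ((Finset.Ico 0 (b * a)).filter fun j => a ∣ j).card = b := by
  rw [Int.Ico_filter_dvd_card _ _ ha]
  have : (a : ℚ) ≠ 0 := by exact_mod_cast ha.ne'
  push_cast
  rw [mul_div_cancel_right₀ _ this]
  simp [hb.le]

/-- Inclusion-exclusion; `M` plays the role of the least common multiple and `r` that of the
greatest common divisor. -/
theorem card_not_dvd_Ico {L K M r : ℤ} (hL : 0 < L) (hK : 0 < K) (hM : 0 < M) (hr : 0 < r)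
    (hMr : K * L = r * M) (hdvd : ∀ j : ℤ, L ∣ j ∧ K ∣ j ↔ M ∣ j) :
    (((Finset.Ico 0 (K * L)).filter fun j => ¬ L ∣ j ∧ ¬ K ∣ j).card : ℤ) = K * L - K - L + r := by
  set I := Finset.Ico 0 (K * L) with hI
  have h1 : ((I.filter fun j => L ∣ j).card : ℤ) = K := card_multiples_Ico hL hK
  have h2 : ((I.filter fun j => K ∣ j).card : ℤ) = L := by
    rw [hI, mul_comm K L]; exact card_multiples_Ico hK hL
  have h3 : ((I.filter fun j => L ∣ j ∧ K ∣ j).card : ℤ) = r := by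
    simp only [hdvd, hI, hMr]
    exact card_multiples_Ico hM hr
  have h4 : (I.card : ℤ) = K * L := by
    rw [hI, Int.card_Ico, sub_zero, Int.toNat_of_nonneg (by positivity)]
  have h5 := Finset.card_union_add_card_inter (I.filter fun j => L ∣ j) (I.filter fun j => K ∣ j)
  rw [← Finset.filter_or, ← Finset.filter_and] at h5
  have h6 := Finset.card_filter_add_card_filter_not (s := I) (fun j => L ∣ j ∨ K ∣ j)
  simp only [not_or] at h6
  zify at h5 h6
  linarith

end EulerProblem

/-! ### Hill's region in elliptic coordinates and the two wells. -/

namespace EulerProblem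

noncomputable section

/-- The value of `cos ν` at a center. -/
def Primary.sign : Primary → ℝ
  | Primary.earth => -1
  | Primary.moon => 1

/-- The elliptic angle `ν` of a center. -/
def Primary.angle : Primary → ℝ
  | Primary.earth => Real.pi
  | Primary.moon => 0

theorem Primary.sign_sq (P : Primary) : P.sign * P.sign = 1 := by
  cases P <;> simp [Primary.sign]

theorem Primary.cos_angle_add (P : Primary) (x : ℝ) :
    Real.cos (P.angle + x) = P.sign * Real.cos x := by
  cases P <;> simp [Primary.sign, Primary.angle, Real.cos_add]

theorem Primary.sin_angle_add (P : Primary) (x : ℝ) :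
    Real.sin (P.angle + x) = P.sign * Real.sin x := by
  cases P <;> simp [Primary.sign, Primary.angle, Real.sin_add]

/-- Elliptic coordinates centered at `P`. -/
def chart (P : Primary) (l x : ℝ) : Plane := PhasePoint.position ⟨l, P.angle + x, 0, 0⟩

/-- A continuous function whose nonpositivity set is Hill's region. -/
def hillFunction (μ c : ℝ) (q : Plane) : ℝ :=
  -(1 - μ) * dist q Primary.moon.pos - μ * dist q Primary.earth.pos
    - c * (dist q Primary.earth.pos * dist q Primary.moon.pos)

/-- The force on `λ`. -/
def lamForce (c y : ℝ) : ℝ := 2 * Real.sinh y + 2 * c * Real.cosh y * Real.sinh y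

/-- The force on `x = ν - ν_P`. -/
def nuForce (μ c : ℝ) (P : Primary) (x : ℝ) : ℝ :=
  Real.sin x * (2 * (P.sign * (1 - 2 * μ)) + 2 * c * Real.cos x)

/-- The potential of `x = ν - ν_P`. -/
def nuPotential (μ c : ℝ) (P : Primary) (x : ℝ) : ℝ :=
  2 * (P.sign * (1 - 2 * μ)) * Real.cos x + c * Real.cos x ^ 2

/-- An interval of values of `λ` containing those on the level `K_λ = g`. -/
def lamRange (g : ℝ) : Set ℝ := Set.Icc (-(|g| + 3)) (|g| + 3)

/-- The values of `x = ν - ν_P` on the side of the center `P`. -/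
def nuRange (μ c : ℝ) (P : Primary) : Set ℝ :=
  {x | |x| < Real.pi ∧ P.sign * (1 - 2 * μ) + c * Real.cos x < 0}

theorem dist_chart_earth (P : Primary) (l x : ℝ) :
    dist (chart P l x) Primary.earth.pos = (Real.cosh l + P.sign * Real.cos x) / 2 := by
  rw [chart, dist_earth, ← P.cos_angle_add]

theorem dist_chart_moon (P : Primary) (l x : ℝ) :
    dist (chart P l x) Primary.moon.pos = (Real.cosh l - P.sign * Real.cos x) / 2 := by
  rw [chart, dist_moon, ← P.cos_angle_add]

theorem chart_zero (P : Primary) : chart P 0 0 = P.pos := by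
  cases P <;> ext i <;> fin_cases i <;>
    simp [chart, Primary.pos, Primary.angle, PhasePoint.position]

theorem continuous_chart (P : Primary) : Continuous fun w : ℝ × ℝ => chart P w.1 w.2 := by
  have h := Real.continuous_cosh
  have h' := Real.continuous_sinh
  unfold chart PhasePoint.position
  refine (PiLp.continuous_toLp 2 _).comp (continuous_pi fun i => ?_)
  fin_cases i
  · change Continuous fun w : ℝ × ℝ => Real.cosh w.1 * Real.cos (P.angle + w.2) / 2
    fun_prop
  · change Continuous fun w : ℝ × ℝ => Real.sinh w.1 * Real.sin (P.angle + w.2) / 2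
    fun_prop

theorem hillFunction_chart (μ c : ℝ) (P : Primary) (l x : ℝ) :
    4 * hillFunction μ c (chart P l x) = kLam c l 0 + nuPotential μ c P x := by
  have := P.sign_sq
  rw [hillFunction, dist_chart_earth, dist_chart_moon, kLam, nuPotential]
  linear_combination (c * Real.cos x ^ 2) * this

theorem continuous_hillFunction (μ c : ℝ) : Continuous (hillFunction μ c) := by
  unfold hillFunction
  fun_prop

theorem dist_earth_moon : dist Primary.earth.pos Primary.moon.pos = 1 := by
  rw [EuclideanSpace.dist_eq]
  norm_num [Fin.sum_univ_two, Primary.pos, Real.dist_eq]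

theorem hillRegion_eq {μ : ℝ} (c : ℝ) (hμ₀ : 0 < μ) (hμ₁ : μ < 1) :
    hillRegion μ c = {q | hillFunction μ c q ≤ 0} := by
  ext q
  simp only [hillRegion, Set.mem_ofPred_eq]
  by_cases hE : q = Primary.earth.pos
  · subst hE
    simp only [true_or, true_iff, hillFunction, dist_self, dist_earth_moon]
    linarith
  by_cases hM : q = Primary.moon.pos
  · subst hM
    simp only [true_or, or_true, true_iff, hillFunction, dist_self,
      dist_comm Primary.moon.pos, dist_earth_moon]
    linarith
  have h1 := dist_pos.2 hE
  have h2 := dist_pos.2 hM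
  simp only [hE, hM, false_or]
  have key : hillFunction μ c q =
      (potential μ q - c) * (dist q Primary.earth.pos * dist q Primary.moon.pos) := by
    rw [hillFunction, potential]
    field_simp
  have h3 := mul_pos h1 h2
  rw [key, ← sub_nonpos (a := potential μ q)]
  exact ⟨fun h => mul_nonpos_of_nonpos_of_nonneg h h3.le, fun h => nonpos_of_mul_nonpos_left h h3⟩

theorem lt_neg_one_of_lt_criticalEnergy {μ c : ℝ} (hc : c < criticalEnergy μ) : c < -1 := by
  have := Real.sqrt_nonneg (μ * (1 - μ))
  unfold criticalEnergy at hc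
  linarith

theorem abs_one_sub_lt {μ : ℝ} (hμ₀ : 0 < μ) (hμ₁ : μ < 1) : |1 - 2 * μ| < 1 := by
  rw [abs_lt]; constructor <;> linarith

theorem Primary.abs_sign_mul (P : Primary) (d : ℝ) : |P.sign * d| = |d| := by
  cases P <;> simp [Primary.sign]

/-- The hyperbola where `K_ν` has its maximum does not meet Hill's region below the critical
energy. -/
theorem side_ne_zero {μ c : ℝ} (hμ₀ : 0 < μ) (hμ₁ : μ < 1) (hc : c < criticalEnergy μ) {q : Plane}
    (hq : hillFunction μ c q ≤ 0) :
    (1 - 2 * μ) + c * (dist q Primary.earth.pos - dist q Primary.moon.pos) ≠ 0 := by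
  intro h0
  have hc1 := lt_neg_one_of_lt_criticalEnergy hc
  have hs : 1 ≤ dist q Primary.earth.pos + dist q Primary.moon.pos := by
    rw [← dist_earth_moon, dist_comm q]
    exact dist_triangle _ _ _
  have hr := Real.sq_sqrt (mul_nonneg hμ₀.le (sub_nonneg.2 hμ₁.le))
  have hr0 := Real.sqrt_nonneg (μ * (1 - μ))
  unfold criticalEnergy at hc
  unfold hillFunction at hq
  set r := √(μ * (1 - μ))
  set a := dist q Primary.earth.pos
  set b := dist q Primary.moon.pos
  set t := a + b with ht
  set f := a - b with hf
  -- This is `4 * hillFunction` in terms of `t = cosh λ` and `f = cos ν`; for `c < -1` its part in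
  -- `t` is smallest at `t = 1`, on the segment between the centers.
  have h1 : -2 * t + 2 * (1 - 2 * μ) * f - c * t ^ 2 + c * f ^ 2 ≤ 0 := by
    rw [ht, hf]; nlinarith
  have h2 : -2 * t - c * t ^ 2 ≥ -2 - c := by nlinarith [mul_nonneg (sub_nonneg.2 hs) (sub_nonneg.2 hs)]
  have hd : 1 - 2 * μ = -c * f := by linarith
  have h3 : -2 - c - c * f ^ 2 ≤ 0 := by rw [hd] at h1; nlinarith
  have h4 : (c * f) ^ 2 = 1 - 4 * r ^ 2 := by
    have : c * f = -(1 - 2 * μ) := by linarith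
    rw [this, hr]; ring
  -- Multiplying `h3` by `c` and using `h4` gives `(c + 1)² ≤ 4r²`, against the factorization `(-1 -
  -- 2r - c)(-1 + 2r - c) > 0`.
  nlinarith [mul_nonneg_of_nonpos_of_nonpos h3 (by linarith : c ≤ 0),
    mul_pos (by linarith : 0 < -1 - 2 * r - c) (by linarith : 0 < -1 + 2 * r - c)]

theorem continuous_dist_sub_dist :
    Continuous fun q : Plane => dist q Primary.earth.pos - dist q Primary.moon.pos := by
  fun_prop

/-- By `side_ne_zero` the second expression cannot vanish on the connected component, and it is
negative at `P`. -/
theorem hillComponent_subset {μ c : ℝ} (hμ₀ : 0 < μ) (hμ₁ : μ < 1) (hc : c < criticalEnergy μ)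
    {P : Primary} {q : Plane} (hq : q ∈ hillComponent μ c P) :
    hillFunction μ c q ≤ 0 ∧ P.sign * ((1 - 2 * μ) +
      c * (dist q Primary.earth.pos - dist q Primary.moon.pos)) < 0 := by
  have hsub : hillComponent μ c P ⊆ {q | hillFunction μ c q ≤ 0} := by
    rw [← hillRegion_eq c hμ₀ hμ₁]
    exact connectedComponentIn_subset _ _
  refine ⟨hsub hq, ?_⟩
  have hc1 := lt_neg_one_of_lt_criticalEnergy hc
  have hP : P.pos ∈ hillComponent μ c P :=
    mem_connectedComponentIn (by cases P <;> simp [hillRegion])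
  set F : Plane → ℝ := fun q => P.sign * ((1 - 2 * μ) +
      c * (dist q Primary.earth.pos - dist q Primary.moon.pos)) with hF
  have hcont : Continuous F := by
    have := continuous_dist_sub_dist
    fun_prop
  have hFP : F P.pos < 0 := by
    simp only [hF]
    cases P
    · rw [dist_self, dist_earth_moon, Primary.sign]; linarith
    · rw [dist_self, dist_comm, dist_earth_moon, Primary.sign]; linarith
  by_contra hneg
  obtain ⟨q', hq', h0⟩ := isPreconnected_connectedComponentIn.intermediate_value hP hq
    hcont.continuousOn ⟨hFP.le, not_lt.1 hneg⟩
  rcases mul_eq_zero.1 h0 with h | h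
  · have := P.sign_sq
    rw [h] at this
    norm_num at this
  · exact side_ne_zero hμ₀ hμ₁ hc (hsub hq') h

theorem kLam_zero_le {c : ℝ} (hc : c < -1) {l l' : ℝ} (h : |l| ≤ |l'|) :
    kLam c l 0 ≤ kLam c l' 0 := by
  have h1 := Real.one_le_cosh l
  have h2 := Real.cosh_le_cosh.2 h
  unfold kLam
  nlinarith [mul_nonneg (sub_nonneg.2 h2) (by nlinarith : 0 ≤ -2 - c * (Real.cosh l' + Real.cosh l))]

theorem kLam_zero_lt {c : ℝ} (hc : c < -1) {l l' : ℝ} (h : |l| < |l'|) :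
    kLam c l 0 < kLam c l' 0 := by
  have h1 := Real.one_le_cosh l
  have h2 := Real.cosh_lt_cosh.2 h
  unfold kLam
  nlinarith [mul_pos (sub_pos.2 h2) (by nlinarith : 0 < -2 - c * (Real.cosh l' + Real.cosh l))]

theorem cos_lt_cos_of_abs_lt {x y : ℝ} (hy : |y| < Real.pi) (h : |x| < |y|) :
    Real.cos y < Real.cos x := by
  rw [← Real.cos_abs x, ← Real.cos_abs y]
  exact Real.cos_lt_cos_of_nonneg_of_le_pi (abs_nonneg x) hy.le h

theorem nuPotential_lt {μ c : ℝ} (hc : c < -1) {P : Primary} {x y : ℝ} (hy : y ∈ nuRange μ c P)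
    (h : |x| < |y|) : nuPotential μ c P x < nuPotential μ c P y := by
  have h1 := cos_lt_cos_of_abs_lt hy.1 h
  have h2 := hy.2
  unfold nuPotential
  nlinarith [mul_pos (sub_pos.2 h1) (by nlinarith : 0 < -(2 * (P.sign * (1 - 2 * μ)) +
    c * (Real.cos x + Real.cos y)))]

theorem nuPotential_le {μ c : ℝ} (hc : c < -1) {P : Primary} {x y : ℝ} (hy : y ∈ nuRange μ c P)
    (h : |x| ≤ |y|) : nuPotential μ c P x ≤ nuPotential μ c P y := by
  rcases h.eq_or_lt with h | h
  · unfold nuPotential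
    rw [← Real.cos_abs x, ← Real.cos_abs y, h]
  · exact (nuPotential_lt hc hy h).le

/-- The ray `s ↦ (sl, sx)` joins the point to `P` inside Hill's region, because both potentials
increase with the absolute value of their argument. -/
theorem chart_mem_hillComponent {μ c : ℝ} (hμ₀ : 0 < μ) (hμ₁ : μ < 1) (hc : c < -1) {P : Primary}
    {l x : ℝ} (hx : x ∈ nuRange μ c P) (hle : kLam c l 0 + nuPotential μ c P x ≤ 0) :
    chart P l x ∈ hillComponent μ c P := by
  set φ : ℝ → Plane := fun s => chart P (s * l) (s * x) with hφ
  have hcont : Continuous φ :=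
    (continuous_chart P).comp (by fun_prop : Continuous fun s : ℝ => (s * l, s * x))
  have hconn : IsPreconnected (φ '' Set.Icc 0 1) :=
    isPreconnected_Icc.image _ hcont.continuousOn
  have hsub : φ '' Set.Icc 0 1 ⊆ hillRegion μ c := by
    rintro _ ⟨s, ⟨hs0, hs1⟩, rfl⟩
    rw [hillRegion_eq c hμ₀ hμ₁]
    have habs : ∀ y : ℝ, |s * y| ≤ |y| := by
      intro y
      rw [abs_mul, abs_of_nonneg hs0]
      exact mul_le_of_le_one_left (abs_nonneg y) hs1
    have h1 := hillFunction_chart μ c P (s * l) (s * x)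
    have h2 := kLam_zero_le hc (habs l)
    have h3 := nuPotential_le hc hx (habs x)
    change hillFunction μ c (chart P (s * l) (s * x)) ≤ 0
    linarith
  have h0 : P.pos ∈ φ '' Set.Icc 0 1 := ⟨0, by simp, by simp [hφ, chart_zero]⟩
  exact hconn.subset_connectedComponentIn h0 hsub ⟨1, by simp, by simp [hφ]⟩

/-- Where the function is negative, a whole ball lies in Hill's region, and by connectedness in the
component. -/
theorem hillFunction_eq_zero_of_mem_frontier {μ c : ℝ} (hμ₀ : 0 < μ) (hμ₁ : μ < 1) {P : Primary}
    {q : Plane} (hq : q ∈ hillComponent μ c P) (hf : q ∈ frontier (hillComponent μ c P)) :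
    hillFunction μ c q = 0 := by
  have hle : hillFunction μ c q ≤ 0 := by
    have := connectedComponentIn_subset _ _ hq
    rwa [hillRegion_eq c hμ₀ hμ₁] at this
  by_contra hne
  have hlt : hillFunction μ c q < 0 := lt_of_le_of_ne hle hne
  have hopen : IsOpen {q | hillFunction μ c q < 0} :=
    isOpen_lt (continuous_hillFunction μ c) continuous_const
  obtain ⟨r, hr, hball⟩ := Metric.isOpen_iff.1 hopen q hlt
  have hsub : Metric.ball q r ⊆ hillRegion μ c := by
    rw [hillRegion_eq c hμ₀ hμ₁]
    exact fun y hy => le_of_lt (show hillFunction μ c y < 0 from hball hy)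
  have hconn : IsPreconnected (Metric.ball q r) := (convex_ball q r).isPreconnected
  have h1 := hconn.subset_connectedComponentIn (Metric.mem_ball_self hr) hsub
  rw [← connectedComponentIn_eq hq] at h1
  exact hf.2 (mem_interior.2 ⟨_, h1, Metric.isOpen_ball, Metric.mem_ball_self hr⟩)

/-- Prolonging the ray from `P` slightly beyond the point strictly raises the potential, hence
leaves Hill's region. -/
theorem chart_mem_frontier {μ c : ℝ} (hμ₀ : 0 < μ) (hμ₁ : μ < 1) (hc : c < -1) {P : Primary}
    {l x : ℝ} (hx : x ∈ nuRange μ c P) (h0 : kLam c l 0 + nuPotential μ c P x = 0) :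
    chart P l x ∈ frontier (hillComponent μ c P) := by
  refine ⟨subset_closure (chart_mem_hillComponent hμ₀ hμ₁ hc hx h0.le), fun hint => ?_⟩
  set φ : ℝ → Plane := fun s => chart P (s * l) (s * x) with hφ
  have hcont : Continuous φ :=
    (continuous_chart P).comp (by fun_prop : Continuous fun s : ℝ => (s * l, s * x))
  have hφ1 : φ 1 = chart P l x := by simp [hφ]
  have e1 : ∀ᶠ s in nhds (1 : ℝ), φ s ∈ hillComponent μ c P := by
    rw [← hφ1] at hint
    exact hcont.continuousAt.eventually (mem_interior_iff_mem_nhds.1 hint)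
  have hopen : IsOpen (nuRange μ c P) := by
    have c1 : Continuous fun x : ℝ => |x| := continuous_abs
    have c2 : Continuous fun x : ℝ => P.sign * (1 - 2 * μ) + c * Real.cos x := by fun_prop
    exact (isOpen_lt c1 continuous_const).inter (isOpen_lt c2 continuous_const)
  have e2 : ∀ᶠ s in nhds (1 : ℝ), s * x ∈ nuRange μ c P := by
    have hc' : Continuous fun s : ℝ => s * x := by fun_prop
    exact hc'.continuousAt.eventually (hopen.mem_nhds (by simpa using hx))
  have e3 : ∀ᶠ s in nhdsWithin (1 : ℝ) (Set.Ioi 1), 1 < s := self_mem_nhdsWithin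
  obtain ⟨s, ⟨hs1, hs2⟩, hs3⟩ :=
    (((e1.and e2).filter_mono nhdsWithin_le_nhds).and e3).exists
  have hle : hillFunction μ c (φ s) ≤ 0 := by
    have := connectedComponentIn_subset _ _ hs1
    rwa [hillRegion_eq c hμ₀ hμ₁] at this
  have h1 := hillFunction_chart μ c P (s * l) (s * x)
  have habs : ∀ y : ℝ, y ≠ 0 → |y| < |s * y| := by
    intro y hy
    rw [abs_mul, abs_of_pos (one_pos.trans hs3)]
    exact lt_mul_left (abs_pos.2 hy) hs3
  have hle' : 4 * hillFunction μ c (φ s) ≤ 0 := by linarith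
  change 4 * hillFunction μ c (chart P (s * l) (s * x)) ≤ 0 at hle'
  by_cases hl : l = 0
  -- The ray degenerates at the center itself, but there the total potential is negative since `|1 -
  -- 2μ| < 1`.
  · by_cases hx0 : x = 0
    · subst hl hx0
      have := hx.2
      simp only [kLam, nuPotential, Real.cosh_zero, Real.cos_zero] at h0 this
      have h5 := P.abs_sign_mul (1 - 2 * μ)
      have h6 := abs_one_sub_lt hμ₀ hμ₁
      rw [← h5, abs_lt] at h6
      linarith
    · have h2 := nuPotential_lt hc hs2 (habs x hx0)
      subst hl
      rw [mul_zero] at h1 hle'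
      linarith
  · have h2 := kLam_zero_lt hc (habs l hl)
    have h3 : nuPotential μ c P x ≤ nuPotential μ c P (s * x) := by
      by_cases hx0 : x = 0
      · simp [hx0]
      · exact (nuPotential_lt hc hs2 (habs x hx0)).le
    linarith

/-- The distances to the centers determine `cosh l` and `cos x`, hence `|l|` and `|x|`; the second
Cartesian coordinate then fixes the product of the signs. -/
theorem chart_eq_iff {P : Primary} {l x l' x' : ℝ} (hx : |x| < Real.pi) (hx' : |x'| < Real.pi) :
    chart P l x = chart P l' x' ↔ (l = l' ∧ x = x') ∨ (l = -l' ∧ x = -x') := by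
  have hs : P.sign ≠ 0 := fun h => by simpa [h] using P.sign_sq
  have hcoord : ∀ l x : ℝ, (chart P l x) 1 = Real.sinh l * (P.sign * Real.sin x) / 2 := by
    intro l x
    simp [chart, PhasePoint.position, P.sin_angle_add]
  constructor
  · intro h
    have h1 := dist_chart_earth P l x
    have h2 := dist_chart_moon P l x
    rw [h, dist_chart_earth] at h1
    rw [h, dist_chart_moon] at h2
    have hcosh : Real.cosh l = Real.cosh l' := by linarith
    have hcos : Real.cos x = Real.cos x' := mul_left_cancel₀ hs (by linarith)
    have hl : |l| = |l'| :=
      le_antisymm (Real.cosh_le_cosh.1 hcosh.le) (Real.cosh_le_cosh.1 hcosh.ge)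
    have hxx : |x| = |x'| := by
      refine Real.injOn_cos ⟨abs_nonneg _, hx.le⟩ ⟨abs_nonneg _, hx'.le⟩ ?_
      simpa using hcos
    have h3 : Real.sinh l * Real.sin x = Real.sinh l' * Real.sin x' := by
      have h4 := hcoord l x
      rw [h, hcoord] at h4
      refine mul_left_cancel₀ hs ?_
      linarith
    have hzero : ∀ {l x : ℝ}, |x| < Real.pi → Real.sinh l * Real.sin x = 0 → l = 0 ∨ x = 0 := by
      intro l x hx h
      rcases mul_eq_zero.1 h with h | h
      · exact Or.inl (Real.sinh_eq_zero.1 h)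
      · rw [abs_lt] at hx
        exact Or.inr ((Real.sin_eq_zero_iff_of_lt_of_lt hx.1 hx.2).1 h)
    rcases abs_eq_abs.1 hl with hl | hl <;> rcases abs_eq_abs.1 hxx with hxx | hxx
    · exact Or.inl ⟨hl, hxx⟩
    · rw [hl, hxx, Real.sin_neg] at h3
      rcases hzero hx' (by linarith) with h | h
      · exact Or.inr ⟨by rw [hl, h, neg_zero], hxx⟩
      · exact Or.inl ⟨hl, by rw [hxx, h, neg_zero]⟩
    · rw [hl, hxx, Real.sinh_neg] at h3
      rcases hzero hx' (by linarith) with h | h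
      · exact Or.inl ⟨by rw [hl, h, neg_zero], hxx⟩
      · exact Or.inr ⟨hl, by rw [hxx, h, neg_zero]⟩
    · exact Or.inr ⟨hl, hxx⟩
  · rintro (⟨rfl, rfl⟩ | ⟨rfl, rfl⟩)
    · rfl
    · ext i
      fin_cases i <;> simp [chart, PhasePoint.position, P.sin_angle_add, P.cos_angle_add]

theorem lamWell {g c : ℝ} (hc : c < -1) (hg : -2 < g + c) :
    IsWell (lamForce c) (fun y => kLam c y 0) (lamRange g) g where
  lipschitz := by
    have h : ContDiff ℝ 1 (lamForce c) := by
      unfold lamForce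
      have h1 := Real.contDiff_sinh (n := 1)
      have h2 := Real.contDiff_cosh (n := 1)
      fun_prop
    exact h.contDiffOn.exists_lipschitzOnWith (by simp) (convex_Icc _ _) isCompact_Icc
  force_neg y := by simp only [lamForce, Real.sinh_neg, Real.cosh_neg]; ring
  potential_neg y := by simp only [kLam, Real.cosh_neg]
  neg_mem y hy := ⟨neg_le_neg hy.2, by linarith [hy.1]⟩
  strictMono x _ y _ h := kLam_zero_lt hc h
  force_pos y _ hy := by
    have h1 := Real.one_le_cosh y
    have h2 := Real.sinh_neg_iff.2 hy
    unfold lamForce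
    nlinarith [mul_pos (neg_pos.2 h2) (by nlinarith : 0 < -(1 + c * Real.cosh y))]
  bottom_lt := by
    simp only [kLam, Real.cosh_zero]
    linarith

theorem nuWell {μ g c : ℝ} (hc : c < -1) {P : Primary}
    (hg : 2 * (P.sign * (1 - 2 * μ)) + c < -g) :
    IsWell (nuForce μ c P) (nuPotential μ c P) (nuRange μ c P) (-g) where
  lipschitz := by
    have h : ContDiff ℝ 1 (nuForce μ c P) := by
      unfold nuForce
      have h1 := Real.contDiff_sin (n := 1)
      have h2 := Real.contDiff_cos (n := 1)
      fun_prop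
    obtain ⟨K, hK⟩ := h.contDiffOn.exists_lipschitzOnWith (by simp)
      (convex_Icc (-Real.pi) Real.pi) isCompact_Icc
    exact ⟨K, hK.mono fun x hx => abs_le.1 hx.1.le⟩
  force_neg y := by simp only [nuForce, Real.sin_neg, Real.cos_neg]; ring
  potential_neg y := by simp only [nuPotential, Real.cos_neg]
  neg_mem y hy := ⟨by rw [abs_neg]; exact hy.1, by rw [Real.cos_neg]; exact hy.2⟩
  strictMono x _ y hy h := nuPotential_lt hc hy h
  force_pos y hy h := by
    have h1 := (abs_lt.1 hy.1).1
    have h2 := Real.sin_neg_of_neg_of_neg_pi_lt h h1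
    unfold nuForce
    have h3 := hy.2
    nlinarith [mul_pos_of_neg_of_neg h2 h3]
  bottom_lt := by
    simp only [nuPotential, Real.cos_zero]
    linarith

/-- A crude a priori bound: a compact range is needed to make the force on `λ` Lipschitz. -/
theorem mem_lamRange {g c l p : ℝ} (hc : c < -1) (h : kLam c l p = g) : l ∈ lamRange g := by
  have h1 := Real.one_le_cosh l
  have h2 : |l| < Real.cosh l := by
    rw [← Real.cosh_abs]
    exact (Real.self_le_sinh_iff.2 (abs_nonneg l)).trans_lt (Real.sinh_lt_cosh _)
  have h3 : Real.cosh l ≤ |g| + 3 := by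
    by_contra hlt
    rw [not_le] at hlt
    have h4 := le_abs_self g
    have h5 := abs_nonneg g
    unfold kLam at h
    nlinarith [sq_nonneg p, mul_pos (by linarith : 0 < Real.cosh l - 2) (by linarith : 0 < Real.cosh l),
      mul_nonneg (by linarith : 0 ≤ -1 - c) (sq_nonneg (Real.cosh l))]
  exact abs_le.1 (h2.le.trans h3)

end

end EulerProblem

/-! ### From trajectories on the torus to pairs of waves. -/

namespace EulerProblem

noncomputable section

theorem IsMinimalPeriod.of_eq_iff {α β : Type*} {F : ℝ → α} {F' : ℝ → β} {T : ℝ}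
    (h : IsMinimalPeriod F T) (he : ∀ a b, F a = F b ↔ F' a = F' b) : IsMinimalPeriod F' T :=
  ⟨h.1, fun t => (he _ _).1 (h.2.1 t), fun T' h0 hp => h.2.2 T' h0 fun t => (he _ _).2 (hp t)⟩

/-- An affine change of time rescales the minimal period; reducing times modulo the new period
matches the visits to a point one by one. -/
theorem quadruplePoints_subset_of_affine {γ F : ℝ → Plane} {a δ : ℝ} (hδ : 0 < δ)
    (h : ∀ u, F u = γ (a + δ * u)) : quadruplePoints γ ⊆ quadruplePoints F := by
  rintro x ⟨T, ⟨hT, hper, hmin⟩, h4⟩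
  have hT' : 0 < T / δ := div_pos hT hδ
  have hFp : Function.Periodic F (T / δ) := by
    intro u
    rw [h, h, ← hper (a + δ * u)]
    congr 1
    field_simp
    ring
  refine ⟨T / δ, ⟨hT', hFp, ?_⟩, ?_⟩
  · intro T' h0 hp
    rw [div_le_iff₀ hδ]
    refine hmin _ (mul_pos h0 hδ) fun t => ?_
    have := hp ((t - a) / δ)
    rw [h, h] at this
    convert this using 2 <;> field_simp <;> ring
  · rw [← h4]
    have hFγ : ∀ t, F ((t - a) / δ) = γ t := by
      intro t
      rw [h]
      congr 1
      field_simp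
      ring
    set φ : ℝ → ℝ := fun t => toIcoMod hT' 0 ((t - a) / δ) with hφ
    have hFφ : ∀ t, F (φ t) = γ t := by
      intro t
      rw [← hFγ t, hφ]
      simp only [toIcoMod]
      exact hFp.sub_zsmul_eq _
    have hinj : Set.InjOn φ {t | t ∈ Set.Ico 0 T ∧ γ t = x} := by
      rintro t ⟨ht, -⟩ t' ⟨ht', -⟩ he
      obtain ⟨n, hn⟩ := (toIcoMod_eq_toIcoMod hT').1 he
      rw [zsmul_eq_mul] at hn
      have e : t' - t = n * T := by
        field_simp at hn
        linarith
      have h1 : toIcoMod hT 0 t = t' :=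
        (toIcoMod_eq_iff hT).2 ⟨by simpa using ht', -n, by rw [zsmul_eq_mul]; push_cast; linarith⟩
      have h2 : toIcoMod hT 0 t = t :=
        (toIcoMod_eq_iff hT).2 ⟨by simpa using ht, 0, by simp⟩
      rw [← h2, h1]
    rw [← hinj.encard_image]
    congr 1
    ext u
    constructor
    · rintro ⟨hu, rfl⟩
      refine ⟨toIcoMod hT 0 (a + δ * u), ⟨by simpa using toIcoMod_mem_Ico hT 0 (a + δ * u), ?_⟩, ?_⟩
      · rw [h]
        simp only [toIcoMod]
        exact hper.sub_zsmul_eq _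
      · refine (toIcoMod_eq_iff hT').2 ⟨by simpa using hu, -toIcoDiv hT 0 (a + δ * u), ?_⟩
        simp only [toIcoMod, zsmul_eq_mul]
        field_simp
        push_cast
        ring
    · rintro ⟨t, ⟨ht, rfl⟩, rfl⟩
      exact ⟨by simpa using toIcoMod_mem_Ico hT' 0 ((t - a) / δ), hFφ t⟩

theorem quadruplePoints_eq_of_affine {γ F : ℝ → Plane} {a δ : ℝ} (hδ : 0 < δ)
    (h : ∀ u, F u = γ (a + δ * u)) : quadruplePoints γ = quadruplePoints F := by
  refine (quadruplePoints_subset_of_affine hδ h).antisymm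
    (quadruplePoints_subset_of_affine (a := -a / δ) (inv_pos.2 hδ) fun t => ?_)
  rw [h]
  congr 1
  field_simp
  ring

theorem isTrajectory_iff {μ c : ℝ} {z : ℝ → PhasePoint} :
    IsTrajectory μ c z ↔ ∀ t, HasDerivAt (fun s => (z s).lam) (4 * (z t).pLam) t ∧
      HasDerivAt (fun s => (z s).nu) (4 * (z t).pNu) t ∧
      HasDerivAt (fun s => (z s).pLam) (lamForce c (z t).lam) t ∧
      HasDerivAt (fun s => (z s).pNu)
        (Real.sin (z t).nu * (2 * (1 - 2 * μ) + 2 * c * Real.cos (z t).nu)) t := by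
  have d1 : ∀ l n p q : ℝ, deriv (fun x => regularizedHamiltonian μ c l n x q) p = 4 * p := by
    intro l n p q
    refine HasDerivAt.deriv ?_
    have h := ((((hasDerivAt_id p).pow 2).const_mul 2).sub_const
      (2 * Real.cosh l)).sub_const (c * Real.cosh l ^ 2) |>.add_const (kNu μ c n q)
    refine (h.congr_deriv ?_)
    simp; ring
  have d2 : ∀ l n p q : ℝ, deriv (fun x => regularizedHamiltonian μ c l n p x) q = 4 * q := by
    intro l n p q
    refine HasDerivAt.deriv ?_
    have h := ((((hasDerivAt_id q).pow 2).const_mul 2).add_const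
      (2 * (1 - 2 * μ) * Real.cos n)).add_const (c * Real.cos n ^ 2) |>.const_add (kLam c l p)
    refine (h.congr_deriv ?_)
    simp; ring
  have d3 : ∀ l n p q : ℝ, -deriv (fun x => regularizedHamiltonian μ c x n p q) l =
      lamForce c l := by
    intro l n p q
    have h := (((Real.hasDerivAt_cosh l).const_mul 2).const_sub (2 * p ^ 2)).sub
      (((Real.hasDerivAt_cosh l).pow 2).const_mul c) |>.add_const (kNu μ c n q)
    have h' : HasDerivAt (fun x => regularizedHamiltonian μ c x n p q) _ l := h
    rw [h'.deriv, lamForce]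
    simp; ring
  have d4 : ∀ l n p q : ℝ, -deriv (fun x => regularizedHamiltonian μ c l x p q) n =
      Real.sin n * (2 * (1 - 2 * μ) + 2 * c * Real.cos n) := by
    intro l n p q
    have h := (((Real.hasDerivAt_cos n).const_mul (2 * (1 - 2 * μ))).const_add (2 * q ^ 2)).add
      (((Real.hasDerivAt_cos n).pow 2).const_mul c) |>.const_add (kLam c l p)
    have h' : HasDerivAt (fun x => regularizedHamiltonian μ c l x p q) _ n := h
    rw [h'.deriv]
    simp; ring
  constructor
  · intro h t
    refine ⟨?_, ?_, ?_, ?_⟩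
    · simpa only [d1] using h.lam t
    · simpa only [d2] using h.nu t
    · simpa only [d3] using h.pLam t
    · simpa only [d4] using h.pNu t
  · intro h
    refine ⟨fun t => ?_, fun t => ?_, fun t => ?_, fun t => ?_⟩
    · simpa only [d1] using (h t).1
    · simpa only [d2] using (h t).2.1
    · simpa only [d3] using (h t).2.2.1
    · simpa only [d4] using (h t).2.2.2

/-- Motion of `(λ, p_λ)` on the level `K_λ = g`. -/
abbrev IsLamMotion (g c : ℝ) (y p : ℝ → ℝ) : Prop :=
  IsOscillation (lamForce c) (fun y => kLam c y 0) (lamRange g) g y p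

/-- Motion of `(ν - ν_P, p_ν)` on the level `K_ν = -g`. -/
abbrev IsNuMotion (μ g c : ℝ) (P : Primary) (y p : ℝ → ℝ) : Prop :=
  IsOscillation (nuForce μ c P) (nuPotential μ c P) (nuRange μ c P) (-g) y p

/-- The lift of `ν` is normalized by a multiple of `2π` so that `x = ν - a` starts in `[-π, π]`. It
can never reach `±π`, which lies on the side of the other center, so one normalization serves for
all times. -/
theorem exists_motions_of_isTrajectory {μ g c : ℝ} (hμ₀ : 0 < μ) (hμ₁ : μ < 1)
    (hc : c < criticalEnergy μ) {P : Primary} {z : ℝ → PhasePoint} (hz : IsTrajectory μ c z)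
    (hzt : ∀ t, z t ∈ liouvilleTorus μ g c P) :
    ∃ a : ℝ, IsLamMotion g c (fun t => (z t).lam) (fun t => (z t).pLam) ∧
      IsNuMotion μ g c P (fun t => (z t).nu - a) (fun t => (z t).pNu) ∧
      ∀ t, (z t).position = chart P (z t).lam ((z t).nu - a) := by
  have hc1 := lt_neg_one_of_lt_criticalEnergy hc
  have hσ := P.sign_sq
  have hder := isTrajectory_iff.1 hz
  have hside : ∀ t, P.sign * (1 - 2 * μ) + c * (P.sign * Real.cos (z t).nu) < 0 := by
    intro t
    have := (hillComponent_subset hμ₀ hμ₁ hc (hzt t).2.2).2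
    rw [dist_earth, dist_moon] at this
    linarith
  set n := round (((z 0).nu - P.angle) / (2 * Real.pi)) with hn
  set a := P.angle + n * (2 * Real.pi) with ha
  have hν : ∀ t, (z t).nu = P.angle + (((z t).nu - a) + n * (2 * Real.pi)) := by
    intro t; rw [ha]; ring
  have hcos : ∀ t, Real.cos (z t).nu = P.sign * Real.cos ((z t).nu - a) := by
    intro t
    rw [hν t, P.cos_angle_add, Real.cos_add_int_mul_two_pi, ← hν t]
  have hsin : ∀ t, Real.sin (z t).nu = P.sign * Real.sin ((z t).nu - a) := by
    intro t
    rw [hν t, P.sin_angle_add, Real.sin_add_int_mul_two_pi, ← hν t]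
  have hside' : ∀ t, P.sign * (1 - 2 * μ) + c * Real.cos ((z t).nu - a) < 0 := by
    intro t
    have := hside t
    rwa [hcos, ← mul_assoc P.sign, hσ, one_mul] at this
  have hne : ∀ t, |(z t).nu - a| ≠ Real.pi := by
    intro t h
    have h1 := hside' t
    rw [← Real.cos_abs, h, Real.cos_pi] at h1
    have h2 := abs_one_sub_lt hμ₀ hμ₁
    rw [← P.abs_sign_mul, abs_lt] at h2
    linarith
  have hcont : Continuous fun t => |(z t).nu - a| := by
    have : Continuous fun t => (z t).nu :=
      continuous_iff_continuousAt.2 fun t => (hder t).2.1.continuousAt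
    fun_prop
  have h0 : |(z 0).nu - a| ≤ Real.pi := by
    have h1 := abs_sub_round (((z 0).nu - P.angle) / (2 * Real.pi))
    rw [← hn] at h1
    have h2 : (z 0).nu - a = (((z 0).nu - P.angle) / (2 * Real.pi) - n) * (2 * Real.pi) := by
      rw [ha]
      field_simp
      ring
    rw [h2, abs_mul, abs_of_pos Real.two_pi_pos]
    nlinarith [Real.pi_pos]
  have habs : ∀ t, |(z t).nu - a| < Real.pi := by
    intro t
    by_contra hge
    obtain ⟨t', ht'⟩ := mem_range_of_exists_le_of_exists_ge hcont ⟨0, h0⟩ ⟨t, not_lt.1 hge⟩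
    exact hne t' ht'
  refine ⟨a, ⟨fun t => (hder t).1, fun t => (hder t).2.2.1, fun t => ?_, fun t => ?_⟩,
    ⟨fun t => (hder t).2.1.sub_const a, fun t => ?_, fun t => ?_, fun t => ⟨habs t, hside' t⟩⟩,
    fun t => ?_⟩
  · have := (hzt t).1
    simp only [kLam] at this ⊢
    linarith
  · exact mem_lamRange hc1 (hzt t).1
  · refine (hder t).2.2.2.congr_deriv ?_
    rw [hcos, hsin, nuForce]
    linear_combination (2 * c * Real.cos ((z t).nu - a) * Real.sin ((z t).nu - a)) * hσ
  · have := (hzt t).2.1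
    simp only [kNu, nuPotential] at this ⊢
    rw [hcos] at this
    linear_combination this - c * Real.cos ((z t).nu - a) ^ 2 * hσ
  · ext i
    fin_cases i
    · simp [chart, PhasePoint.position, P.cos_angle_add, hcos]
    · simp [chart, PhasePoint.position, P.sin_angle_add, hsin]

theorem chart_motion_mem_torusOrbits {μ g c : ℝ} (hμ₀ : 0 < μ) (hμ₁ : μ < 1) (hc : c < -1)
    {P : Primary} {y p y' p' : ℝ → ℝ} (h : IsLamMotion g c y p) (h' : IsNuMotion μ g c P y' p') :
    (fun t => chart P (y t) (y' t)) ∈ torusOrbits μ g c P := by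
  have hσ := P.sign_sq
  refine ⟨fun t => ⟨y t, P.angle + y' t, p t, p' t⟩, isTrajectory_iff.2 fun t =>
    ⟨h.pos t, (h'.pos t).const_add _, h.mom t, ?_⟩, fun t => ⟨?_, ?_, ?_⟩, rfl⟩
  · refine (h'.mom t).congr_deriv ?_
    simp only [P.cos_angle_add, P.sin_angle_add, nuForce]
    linear_combination (-2 * c * Real.cos (y' t) * Real.sin (y' t)) * hσ
  · have := h.energy t
    simp only [kLam] at this ⊢
    linarith
  · have := h'.energy t
    simp only [kNu, nuPotential, P.cos_angle_add] at this ⊢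
    linear_combination this + c * Real.cos (y' t) ^ 2 * hσ
  · refine chart_mem_hillComponent hμ₀ hμ₁ hc (h'.mem t) ?_
    have h1 := h.energy t
    have h2 := h'.energy t
    nlinarith [sq_nonneg (p t), sq_nonneg (p' t)]

/-- Waves `Y₁`, `Y₂` of half periods `h₁`, `h₂` from which the brake orbits of a torus are built. -/
structure IsBrakeFrame (μ g c : ℝ) (P : Primary) (h₁ h₂ : ℝ) (Y₁ Q₁ Y₂ Q₂ : ℝ → ℝ) : Prop where
  lam : IsLamMotion g c Y₁ Q₁
  nu : IsNuMotion μ g c P Y₂ Q₂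
  lamWell : IsWell (lamForce c) (fun y => kLam c y 0) (lamRange g) g
  nuWell : IsWell (nuForce μ c P) (nuPotential μ c P) (nuRange μ c P) (-g)
  lam_wave : IsSymmetricWave Y₁ h₁
  nu_wave : IsSymmetricWave Y₂ h₂
  lam_rest : Q₁ 0 = 0
  nu_rest : Q₂ 0 = 0
  lam_unique : ∀ y p, IsLamMotion g c y p → ∀ t₀, p t₀ = 0 →
    (∀ t, y (t₀ + t) = Y₁ t) ∨ (∀ t, y (t₀ + t) = -Y₁ t)
  nu_unique : ∀ y p, IsNuMotion μ g c P y p → ∀ t₀, p t₀ = 0 →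
    (∀ t, y (t₀ + t) = Y₂ t) ∨ (∀ t, y (t₀ + t) = -Y₂ t)

/-- The periodic motions that witness the rotation number supply both waves; the bounds on `g + c`
put their energies strictly above the bottoms of the wells. -/
theorem exists_isBrakeFrame {μ g c : ℝ} (hμ₀ : 0 < μ) (hμ₁ : μ < 1)
    (hgc : InRegionS μ g c ∨ InRegionS' μ g c) {P : Primary} {R : ℝ}
    (hR : HasRotationNumber μ g c P R) :
    c < criticalEnergy μ ∧ ∃ T₁ T₂, R = T₂ / T₁ ∧ ∃ Y₁ Q₁ Y₂ Q₂,
      IsBrakeFrame μ g c P (T₁ / 2) (T₂ / 2) Y₁ Q₁ Y₂ Q₂ := by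
  have hc : c < criticalEnergy μ := by rcases hgc with h | h <;> exact h.1
  have hc1 := lt_neg_one_of_lt_criticalEnergy hc
  have hd := abs_one_sub_lt hμ₀ hμ₁
  obtain ⟨z, T₁, T₂, hz, hzt, hT₁, hT₂, rfl⟩ := hR
  refine ⟨hc, T₁, T₂, rfl, ?_⟩
  obtain ⟨a, hl, hn, -⟩ := exists_motions_of_isTrajectory hμ₀ hμ₁ hc hz hzt
  have hg : -2 < g + c := by
    rcases hgc with h | h
    · exact h.2.1
    · have := h.2.1; linarith
  have hbot : 2 * (P.sign * (1 - 2 * μ)) + c < -g := by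
    have hle := le_abs_self (P.sign * (1 - 2 * μ))
    rw [P.abs_sign_mul] at hle
    rcases hgc with h | h
    · have := h.2.2; linarith
    -- In `S'` the motion itself shows that the level is not below the bottom. This rules out the
    -- lighter center, and the upper bound on `g + c` makes the inequality strict.
    · have h1 : 2 * (P.sign * (1 - 2 * μ)) + c ≤ -g := by
        have h2 := hn.energy 0
        have h3 := nuPotential_le hc1 (hn.mem 0) (x := 0) (by simp)
        simp only [nuPotential, Real.cos_zero] at h2 h3
        nlinarith [sq_nonneg (z 0).pNu]
      have h4 := h.2.1
      have h5 := h.2.2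
      rcases abs_choice (P.sign * (1 - 2 * μ)) with h6 | h6 <;> rw [P.abs_sign_mul] at h6 <;>
        linarith
  have w₁ := lamWell hc1 hg
  have w₂ := nuWell hc1 hbot
  obtain ⟨Y₁, Q₁, a1, a2, a3, a4⟩ := hl.exists_symmetricWave w₁ hT₁
  obtain ⟨Y₂, Q₂, b1, b2, b3, b4⟩ := hn.exists_symmetricWave w₂ (hT₂.of_eq_iff (by simp))
  exact ⟨Y₁, Q₁, Y₂, Q₂, a1, b1, w₁, w₂, a2, b2, a3, b3, a4, b4⟩

end

end EulerProblem

/-! ### Brake curves: symmetries, coincidences and classification. -/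

namespace EulerProblem

noncomputable section

theorem IsSymmetricWave.even {y : ℝ → ℝ} {h : ℝ} (w : IsSymmetricWave y h) (t : ℝ) :
    y (-t) = y t :=
  (w.eq_iff _ _).2 ⟨0, by simp, Or.inr (by simp)⟩

theorem IsSymmetricWave.add_mul_even {y : ℝ → ℝ} {h : ℝ} (w : IsSymmetricWave y h) {m : ℤ}
    (hm : Even m) (t : ℝ) : y (t + m * h) = y t :=
  (w.eq_iff _ _).2 ⟨m, hm, Or.inl rfl⟩

theorem IsSymmetricWave.add_mul_odd {y : ℝ → ℝ} {h : ℝ} (w : IsSymmetricWave y h) {m : ℤ}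
    (hm : Odd m) (t : ℝ) : y (t + m * h) = -y t :=
  (w.eq_neg_iff _ _).2 ⟨m, hm, Or.inl rfl⟩

theorem IsSymmetricWave.half_eq_zero {y : ℝ → ℝ} {h : ℝ} (w : IsSymmetricWave y h) {m : ℤ}
    (hm : Odd m) : y (m * (h / 2)) = 0 := by
  have h1 := w.add_mul_odd hm (-(m * (h / 2)))
  rw [w.even] at h1
  have e : -(m * (h / 2)) + m * h = m * (h / 2) := by ring
  rw [e] at h1
  linarith

theorem chart_neg (P : Primary) (l x : ℝ) : chart P (-l) (-x) = chart P l x := by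
  ext i
  fin_cases i <;> simp [chart, PhasePoint.position, P.sin_angle_add, P.cos_angle_add]

/-- An even curve retraces itself, with opposite velocities at `t` and `-t`; being nonconstant, it
has a nonzero velocity somewhere. -/
theorem hasInverseSelfTangency_of_even {γ : ℝ → Plane} (hd : Differentiable ℝ γ)
    (heven : ∀ t, γ (-t) = γ t) (hne : ∃ t, γ t ≠ γ 0) : HasInverseSelfTangency γ := by
  obtain ⟨t, ht⟩ : ∃ t, deriv γ t ≠ 0 := by
    by_contra! h
    obtain ⟨t, ht⟩ := hne
    exact ht (is_const_of_deriv_eq_zero hd h _ _)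
  refine ⟨t, -t, 1, (heven t).symm, ht, one_pos, ?_⟩
  have h1 := deriv_comp_neg γ t
  have h2 : (fun x => γ (-x)) = γ := funext heven
  rw [h2] at h1
  rw [h1, one_smul, neg_neg]

/-- The brake curve through the corner `(Y₁ 0, ε Y₂ 0)`, where `ε = ±1`. -/
def brakeCurve (P : Primary) (Y₁ Y₂ : ℝ → ℝ) (ε : ℝ) (t : ℝ) : Plane := chart P (Y₁ t) (ε * Y₂ t)

section

variable {μ g c : ℝ} {P : Primary} {h₁ h₂ : ℝ} {Y₁ Q₁ Y₂ Q₂ : ℝ → ℝ} {ε : ℝ} {L K : ℤ} {δ : ℝ}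

theorem differentiable_chart_comp (P : Primary) {y y' : ℝ → ℝ} (h : Differentiable ℝ y)
    (h' : Differentiable ℝ y') : Differentiable ℝ fun t => chart P (y t) (y' t) := by
  rw [differentiable_piLp]
  intro i
  fin_cases i
  · change Differentiable ℝ fun t => Real.cosh (y t) * Real.cos (P.angle + y' t) / 2
    fun_prop
  · change Differentiable ℝ fun t => Real.sinh (y t) * Real.sin (P.angle + y' t) / 2
    fun_prop

theorem IsBrakeFrame.differentiable (f : IsBrakeFrame μ g c P h₁ h₂ Y₁ Q₁ Y₂ Q₂) (ε : ℝ) :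
    Differentiable ℝ (brakeCurve P Y₁ Y₂ ε) := by
  have d1 : Differentiable ℝ Y₁ := fun t => (f.lam.pos t).differentiableAt
  have d2 : Differentiable ℝ Y₂ := fun t => (f.nu.pos t).differentiableAt
  exact differentiable_chart_comp P d1 (d2.const_mul ε)

theorem IsBrakeFrame.even (f : IsBrakeFrame μ g c P h₁ h₂ Y₁ Q₁ Y₂ Q₂) (ε t : ℝ) :
    brakeCurve P Y₁ Y₂ ε (-t) = brakeCurve P Y₁ Y₂ ε t := by
  simp only [brakeCurve, f.lam_wave.even, f.nu_wave.even]

theorem IsBrakeFrame.brakeCurve_mem (f : IsBrakeFrame μ g c P h₁ h₂ Y₁ Q₁ Y₂ Q₂) (hμ₀ : 0 < μ)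
    (hμ₁ : μ < 1) (hc : c < -1) (hε : ε = 1 ∨ ε = -1) :
    brakeCurve P Y₁ Y₂ ε ∈ torusOrbits μ g c P := by
  rcases hε with rfl | rfl
  · have := chart_motion_mem_torusOrbits hμ₀ hμ₁ hc f.lam f.nu
    convert this using 2 with t
    simp [brakeCurve]
  · have := chart_motion_mem_torusOrbits hμ₀ hμ₁ hc f.lam (f.nu.neg f.nuWell)
    convert this using 2 with t
    simp [brakeCurve]

theorem IsBrakeFrame.abs_lt (f : IsBrakeFrame μ g c P h₁ h₂ Y₁ Q₁ Y₂ Q₂)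
    (hε : ε = 1 ∨ ε = -1) (t : ℝ) : |ε * Y₂ t| < Real.pi := by
  have := (f.nu.mem t).1
  rcases hε with rfl | rfl <;> simpa using this

/-- The two alternatives in `chart_eq_iff` correspond to `m`, `n` both even and both odd. -/
theorem IsBrakeFrame.brakeCurve_eq_iff (f : IsBrakeFrame μ g c P (L * δ) (K * δ) Y₁ Q₁ Y₂ Q₂)
    (hδ : 0 < δ) (hε : ε = 1 ∨ ε = -1) (u' u : ℝ) :
    brakeCurve P Y₁ Y₂ ε (δ * u') = brakeCurve P Y₁ Y₂ ε (δ * u) ↔ Coincide L K u' u := by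
  have hε0 : ε ≠ 0 := by rcases hε with rfl | rfl <;> norm_num
  have hcancel : ∀ (m : ℤ) (M : ℤ),
      (δ * u' = δ * u + m * (M * δ) ∨ δ * u' = -(δ * u) + m * (M * δ)) ↔
        (u' = u + m * M ∨ u' = -u + m * M) := by
    intro m M
    have e1 : δ * u + m * (M * δ) = δ * (u + m * M) := by ring
    have e2 : -(δ * u) + m * (M * δ) = δ * (-u + m * M) := by ring
    rw [e1, e2, mul_right_inj' hδ.ne', mul_right_inj' hδ.ne']
  rw [brakeCurve, brakeCurve, chart_eq_iff (f.abs_lt hε _) (f.abs_lt hε _), ← mul_neg,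
    mul_right_inj' hε0, mul_right_inj' hε0, f.lam_wave.eq_iff, f.lam_wave.eq_neg_iff,
    f.nu_wave.eq_iff, f.nu_wave.eq_neg_iff]
  simp only [hcancel]
  constructor
  · rintro (⟨⟨m, hm, h1⟩, n, hn, h2⟩ | ⟨⟨m, hm, h1⟩, n, hn, h2⟩)
    · exact ⟨m, n, hm.sub hn, h1, h2⟩
    · exact ⟨m, n, hm.sub_odd hn, h1, h2⟩
  · rintro ⟨m, n, hmn, h1, h2⟩
    rcases Int.even_or_odd m with hm | hm
    · exact Or.inl ⟨⟨m, hm, h1⟩, n, (Int.even_sub.1 hmn).1 hm, h2⟩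
    · refine Or.inr ⟨⟨m, hm, h1⟩, n, ?_, h2⟩
      rw [← Int.not_even_iff_odd] at hm ⊢
      exact fun h => hm ((Int.even_sub.1 hmn).2 h)

theorem IsBrakeFrame.energy_zero (f : IsBrakeFrame μ g c P h₁ h₂ Y₁ Q₁ Y₂ Q₂) :
    kLam c (Y₁ 0) 0 + nuPotential μ c P (Y₂ 0) = 0 := by
  have h1 : 2 * Q₁ 0 ^ 2 + kLam c (Y₁ 0) 0 = g := f.lam.energy 0
  have h2 := f.nu.energy 0
  rw [f.lam_rest] at h1
  rw [f.nu_rest] at h2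
  linarith

/-- At a common multiple of the half periods both waves are at turning points, so no kinetic energy
is left. -/
theorem IsBrakeFrame.mem_frontier (f : IsBrakeFrame μ g c P h₁ h₂ Y₁ Q₁ Y₂ Q₂) (hμ₀ : 0 < μ)
    (hμ₁ : μ < 1) (hc : c < -1) (hε : ε = 1 ∨ ε = -1) {t : ℝ} (m n : ℤ) (hm : t = m * h₁)
    (hn : t = n * h₂) : brakeCurve P Y₁ Y₂ ε t ∈ frontier (hillComponent μ c P) := by
  have e1 : Y₁ t = Y₁ 0 ∨ Y₁ t = -Y₁ 0 := by
    rw [hm, ← zero_add (m * h₁)]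
    rcases Int.even_or_odd m with h | h
    · exact Or.inl (f.lam_wave.add_mul_even h 0)
    · exact Or.inr (f.lam_wave.add_mul_odd h 0)
  have e2 : Y₂ t = Y₂ 0 ∨ Y₂ t = -Y₂ 0 := by
    rw [hn, ← zero_add (n * h₂)]
    rcases Int.even_or_odd n with h | h
    · exact Or.inl (f.nu_wave.add_mul_even h 0)
    · exact Or.inr (f.nu_wave.add_mul_odd h 0)
  have h1 : kLam c (Y₁ t) 0 = kLam c (Y₁ 0) 0 := by
    rcases e1 with e | e
    · rw [e]
    · rw [e]; exact f.lamWell.potential_neg _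
  have h2 : nuPotential μ c P (ε * Y₂ t) = nuPotential μ c P (Y₂ 0) := by
    rcases hε with rfl | rfl <;> rcases e2 with e | e <;> rw [e] <;>
      simp [f.nuWell.potential_neg]
  have h3 : ε * Y₂ t ∈ nuRange μ c P := by
    rcases hε with rfl | rfl
    · simpa using f.nu.mem t
    · simpa using f.nuWell.neg_mem _ (f.nu.mem t)
  exact chart_mem_frontier hμ₀ hμ₁ hc h3 (by rw [h1, h2]; exact f.energy_zero)

/-- On the boundary the two potentials add up to `0`, as do the two energies, so `p_λ` and `p_ν`
vanish together. Four sign choices remain, and `chart_neg` identifies them in pairs. -/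
theorem IsBrakeFrame.exists_eq_brakeCurve (f : IsBrakeFrame μ g c P h₁ h₂ Y₁ Q₁ Y₂ Q₂)
    (hμ₀ : 0 < μ) (hμ₁ : μ < 1) (hc : c < criticalEnergy μ) {γ : ℝ → Plane}
    (hγ : γ ∈ torusOrbits μ g c P) {t₀ : ℝ} (ht : γ t₀ ∈ frontier (hillComponent μ c P)) :
    ∃ ε : ℝ, (ε = 1 ∨ ε = -1) ∧ ∀ t, brakeCurve P Y₁ Y₂ ε t = γ (t₀ + t) := by
  obtain ⟨z, hz, hzt, rfl⟩ := hγ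
  obtain ⟨a, hl, hn, hpos⟩ := exists_motions_of_isTrajectory hμ₀ hμ₁ hc hz hzt
  have h0 := hillFunction_eq_zero_of_mem_frontier hμ₀ hμ₁ (hzt t₀).2.2 ht
  rw [hpos] at h0
  have h1 := hillFunction_chart μ c P (z t₀).lam ((z t₀).nu - a)
  have h2 : 2 * (z t₀).pLam ^ 2 + kLam c (z t₀).lam 0 = g := hl.energy t₀
  have h3 := hn.energy t₀
  have hp1 : (z t₀).pLam = 0 := by
    nlinarith [sq_nonneg (z t₀).pLam, sq_nonneg (z t₀).pNu]
  have hp2 : (z t₀).pNu = 0 := by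
    nlinarith [sq_nonneg (z t₀).pLam, sq_nonneg (z t₀).pNu]
  rcases f.lam_unique _ _ hl t₀ hp1 with e1 | e1 <;>
    rcases f.nu_unique _ _ hn t₀ hp2 with e2 | e2
  · exact ⟨1, Or.inl rfl, fun t => by simp only [hpos, e1, e2, brakeCurve, one_mul]⟩
  · exact ⟨-1, Or.inr rfl, fun t => by simp only [hpos, e1, e2, brakeCurve, neg_one_mul]⟩
  · refine ⟨-1, Or.inr rfl, fun t => ?_⟩
    simp only [hpos, e1, e2, brakeCurve, neg_one_mul]
    rw [← chart_neg, neg_neg]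
  · refine ⟨1, Or.inl rfl, fun t => ?_⟩
    simp only [hpos, e1, e2, brakeCurve, one_mul]
    rw [chart_neg]

theorem IsBrakeFrame.periodic (f : IsBrakeFrame μ g c P (L * δ) (K * δ) Y₁ Q₁ Y₂ Q₂)
    (h : IsHalfPeriodPair L K) (hδ : 0 < δ) (hε : ε = 1 ∨ ε = -1) :
    ∃ T, 0 < T ∧ Function.Periodic (brakeCurve P Y₁ Y₂ ε) T := by
  have hm := isMinimalPeriod_of_coincide h (f.brakeCurve_eq_iff hδ hε)
  refine ⟨δ * (K * L), mul_pos hδ hm.1, fun t => ?_⟩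
  have := hm.2.1 (t / δ)
  simpa [mul_add, mul_div_cancel₀ t hδ.ne'] using this

theorem IsBrakeFrame.hasInverseSelfTangency
    (f : IsBrakeFrame μ g c P (L * δ) (K * δ) Y₁ Q₁ Y₂ Q₂) (hδ : 0 < δ)
    (hε : ε = 1 ∨ ε = -1) : HasInverseSelfTangency (brakeCurve P Y₁ Y₂ ε) := by
  -- Half a time unit cannot coincide with time `0`, since it is not an integer.
  refine hasInverseSelfTangency_of_even (f.differentiable ε) (f.even ε) ⟨δ * (1 / 2), fun h => ?_⟩
  rw [← mul_zero δ, f.brakeCurve_eq_iff hδ hε] at h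
  obtain ⟨m, n, -, h1, -⟩ := h
  have h2 : (1 : ℝ) / 2 = m * L := by rcases h1 with h1 | h1 <;> simpa using h1
  have h3 : (1 : ℝ) = ((2 * (m * L) : ℤ) : ℝ) := by push_cast; linarith
  have h4 : (1 : ℤ) = 2 * (m * L) := by exact_mod_cast h3
  omega

open Classical in
theorem IsBrakeFrame.quadruplePoints_eq
    (f : IsBrakeFrame μ g c P (L * δ) (K * δ) Y₁ Q₁ Y₂ Q₂) (h : IsHalfPeriodPair L K)
    (hδ : 0 < δ) (hμ₀ : 0 < μ) (hμ₁ : μ < 1) (hc : c < criticalEnergy μ) {γ : ℝ → Plane}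
    (hγ : γ ∈ torusOrbits μ g c P) {t₀ : ℝ} (ht : γ t₀ ∈ frontier (hillComponent μ c P)) :
    (quadruplePoints γ).Finite ∧ 4 * (quadruplePoints γ).ncard =
      ((Finset.Ico 0 (K * L)).filter fun j => ¬ L ∣ j ∧ ¬ K ∣ j).card := by
  obtain ⟨ε, hε, he⟩ := f.exists_eq_brakeCurve hμ₀ hμ₁ hc hγ ht
  rw [quadruplePoints_eq_of_affine (F := fun u => brakeCurve P Y₁ Y₂ ε (δ * u)) hδ
    fun u => he (δ * u)]
  exact quadruplePoints_of_coincide h (f.brakeCurve_eq_iff hδ hε)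

theorem range_eq_of_shift {γ Γ : ℝ → Plane} {t₀ : ℝ} (h : ∀ t, Γ t = γ (t₀ + t)) :
    Set.range γ = Set.range Γ := by
  ext x
  constructor
  · rintro ⟨t, rfl⟩
    exact ⟨t - t₀, by rw [h]; congr 1; ring⟩
  · rintro ⟨t, rfl⟩
    exact ⟨t₀ + t, (h t).symm⟩

theorem exists_time_unit {T₁ T₂ : ℝ} {k l : ℕ} (hk : 0 < k) (hl : 0 < l) (hT₁ : 0 < T₁)
    (hR : (k : ℝ) / l = T₂ / T₁) (hL : 0 < L) (hLK : L * k = K * l) :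
    ∃ δ : ℝ, 0 < δ ∧ T₁ / 2 = L * δ ∧ T₂ / 2 = K * δ := by
  have hL' : (0 : ℝ) < L := by exact_mod_cast hL
  have hl' : (0 : ℝ) < l := by exact_mod_cast hl
  have hLK' : (L : ℝ) * k = K * l := by exact_mod_cast hLK
  refine ⟨T₁ / 2 / L, by positivity, by field_simp, ?_⟩
  rw [div_eq_div_iff hl'.ne' hT₁.ne'] at hR
  have h1 : T₂ = k * T₁ / l := by rw [hR]; field_simp
  have h2 : (K : ℝ) = L * k / l := by rw [hLK']; field_simp
  rw [h1, h2]
  field_simp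

/-- After the time `k h₁ = l h₂` exactly one wave has changed sign, which amounts to replacing `ε`
by `-ε`. -/
theorem IsBrakeFrame.range_neg_one (f : IsBrakeFrame μ g c P h₁ h₂ Y₁ Q₁ Y₂ Q₂) {k l : ℕ}
    (ho : Odd (k + l)) (h : k * h₁ = l * h₂) :
    Set.range (brakeCurve P Y₁ Y₂ 1) = Set.range (brakeCurve P Y₁ Y₂ (-1)) := by
  refine range_eq_of_shift (t₀ := k * h₁) fun t => ?_
  rw [add_comm (k * h₁) t]
  simp only [brakeCurve, neg_one_mul, one_mul]
  rcases Nat.even_or_odd k with hk | hk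
  · have hl : Odd l := by
      rw [← Nat.not_even_iff_odd] at ho ⊢
      exact fun hl => ho (hk.add hl)
    have e1 := f.lam_wave.add_mul_even (m := k) (by exact_mod_cast hk) t
    have e2 := f.nu_wave.add_mul_odd (m := l) (by exact_mod_cast hl) t
    push_cast at e1 e2
    rw [e1, h, e2]
  · have hl : Even l := by
      by_contra hl
      rw [Nat.not_even_iff_odd] at hl
      exact (Nat.not_even_iff_odd.2 ho) (hk.add_odd hl)
    have e1 := f.lam_wave.add_mul_odd (m := k) (by exact_mod_cast hk) t
    have e2 := f.nu_wave.add_mul_even (m := l) (by exact_mod_cast hl) t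
    push_cast at e1 e2
    rw [e1, h, e2, ← chart_neg, neg_neg]

/-- Reaching the corner of the other curve needs `m h₁ = n h₂` with `m - n` odd; but then `ml = nk`
with `k`, `l` odd, so `m` and `n` have equal parity. -/
theorem IsBrakeFrame.range_ne (f : IsBrakeFrame μ g c P h₁ h₂ Y₁ Q₁ Y₂ Q₂) {k l : ℕ}
    (hk : Odd k) (hl : Odd l) (h : k * h₁ = l * h₂) :
    Set.range (brakeCurve P Y₁ Y₂ 1) ≠ Set.range (brakeCurve P Y₁ Y₂ (-1)) := by
  intro he
  obtain ⟨t, ht⟩ : brakeCurve P Y₁ Y₂ (-1) 0 ∈ Set.range (brakeCurve P Y₁ Y₂ 1) := by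
    rw [he]; exact ⟨0, rfl⟩
  rw [brakeCurve, brakeCurve, chart_eq_iff (f.abs_lt (Or.inl rfl) _) (f.abs_lt (Or.inr rfl) _)] at ht
  simp only [one_mul, neg_one_mul, neg_neg] at ht
  rw [f.lam_wave.eq_iff, f.lam_wave.eq_neg_iff, f.nu_wave.eq_iff, f.nu_wave.eq_neg_iff] at ht
  obtain ⟨m, n, hmn, h1, h2⟩ : ∃ m n : ℤ, Odd (m - n) ∧ t = m * h₁ ∧ t = n * h₂ := by
    rcases ht with ⟨⟨m, hm, h1⟩, n, hn, h2⟩ | ⟨⟨m, hm, h1⟩, n, hn, h2⟩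
    · exact ⟨m, n, hm.sub_odd hn, by simpa using h1, by simpa using h2⟩
    · exact ⟨m, n, hm.sub_even hn, by simpa using h1, by simpa using h2⟩
  have e : (m : ℝ) * l = n * k := by
    apply mul_right_cancel₀ f.nu_wave.pos.ne'
    calc (m : ℝ) * l * h₂ = m * (k * h₁) := by rw [h]; ring
      _ = k * (m * h₁) := by ring
      _ = n * k * h₂ := by rw [← h1, h2]; ring
  have e' : m * l = n * k := by exact_mod_cast e
  have hk' : Odd (k : ℤ) := by exact_mod_cast hk
  have hl' : Odd (l : ℤ) := by exact_mod_cast hl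
  have p : Even m ↔ Even n := by
    have p1 : Even (m * l) ↔ Even m := by
      rw [Int.even_mul, or_iff_left (Int.not_even_iff_odd.2 hl')]
    have p2 : Even (n * k) ↔ Even n := by
      rw [Int.even_mul, or_iff_left (Int.not_even_iff_odd.2 hk')]
    rw [← p1, ← p2, e']
  exact (Int.not_even_iff_odd.2 hmn) (Int.even_sub.2 p)

end

end

end EulerProblem

/-! ### Counting the orbits and their quadruple points. -/

theorem proposition4p3 (μ g c : ℝ) (hμ₀ : 0 < μ) (hμ₁ : μ < 1)
    (hgc : EulerProblem.InRegionS μ g c ∨ EulerProblem.InRegionS' μ g c)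
    (P : EulerProblem.Primary) (k l : ℕ)
    (hT : EulerProblem.IsTorusOfType μ g c P k l) :
    (Odd (k + l) →
      (Set.range '' EulerProblem.brakeBrakeOrbits μ g c P).encard = 1 ∧
      ∀ γ ∈ EulerProblem.brakeBrakeOrbits μ g c P,
        (EulerProblem.quadruplePoints γ).Finite ∧
        ((EulerProblem.quadruplePoints γ).ncard : ℝ) =
          ((k : ℝ) - 1) * ((l : ℝ) - 1) + ((k : ℝ) + (l : ℝ) - 1) / 2) ∧
    (Even (k + l) →
      (Set.range '' EulerProblem.brakeCollisionOrbits μ g c P).encard = 2 ∧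
      ∀ γ ∈ EulerProblem.brakeCollisionOrbits μ g c P,
        (EulerProblem.quadruplePoints γ).Finite ∧
        ((EulerProblem.quadruplePoints γ).ncard : ℝ) =
          ((k : ℝ) - 1) * ((l : ℝ) - 1) / 4) := by
  classical
  obtain ⟨hk, hl, hkl, hR⟩ := hT
  obtain ⟨hc, T₁, T₂, hR, Y₁, Q₁, Y₂, Q₂, f⟩ :=
    EulerProblem.exists_isBrakeFrame hμ₀ hμ₁ hgc hR
  have hc1 := EulerProblem.lt_neg_one_of_lt_criticalEnergy hc
  have hT₁ : 0 < T₁ := by have := f.lam_wave.pos; linarith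
  have hkl' : IsCoprime (k : ℤ) (l : ℤ) := Nat.isCoprime_iff_coprime.2 hkl
  have hkZ : (0 : ℤ) < k := by exact_mod_cast hk
  have hlZ : (0 : ℤ) < l := by exact_mod_cast hl
  constructor
  · intro ho
    have hp := EulerProblem.isHalfPeriodPair_of_odd_add hk hl hkl ho
    obtain ⟨δ, hδ, e1, e2⟩ := EulerProblem.exists_time_unit (L := 2 * l) (K := 2 * k) hk hl hT₁ hR
      hp.pos_left (by ring)
    rw [e1, e2] at f
    have hshift : (k : ℝ) * (((2 * l : ℤ) : ℝ) * δ) = l * (((2 * k : ℤ) : ℝ) * δ) := by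
      push_cast; ring
    refine ⟨?_, ?_⟩
    · have hset : Set.range '' EulerProblem.brakeBrakeOrbits μ g c P =
          {Set.range (EulerProblem.brakeCurve P Y₁ Y₂ 1)} := by
        ext S
        rw [Set.mem_singleton_iff]
        constructor
        · rintro ⟨γ, ⟨hγ, -, -, t₀, -, ht₀, -⟩, rfl⟩
          obtain ⟨ε, hε, he⟩ := f.exists_eq_brakeCurve hμ₀ hμ₁ hc hγ ht₀
          rw [EulerProblem.range_eq_of_shift he]
          rcases hε with rfl | rfl
          · rfl
          · exact (f.range_neg_one ho hshift).symm
        · rintro rfl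
          -- The boundary is touched at time `0` and at `2klδ = k h₁ = l h₂`; the points differ
          -- because a coincidence would force `m = k`, `n = l`, of opposite parity.
          refine ⟨_, ⟨f.brakeCurve_mem hμ₀ hμ₁ hc1 (Or.inl rfl), f.periodic hp hδ (Or.inl rfl),
            f.hasInverseSelfTangency hδ (Or.inl rfl), δ * 0, δ * (2 * k * l : ℤ),
            f.mem_frontier hμ₀ hμ₁ hc1 (Or.inl rfl) 0 0 (by simp) (by simp),
            f.mem_frontier hμ₀ hμ₁ hc1 (Or.inl rfl) k l (by push_cast; ring)
              (by push_cast; ring), ?_⟩, rfl⟩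
          rw [ne_comm, Ne, f.brakeCurve_eq_iff hδ (Or.inl rfl)]
          rintro ⟨m, n, hmn, h1, h2⟩
          have h1' : 2 * (k : ℤ) * l = m * (2 * l) := by
            rcases h1 with h1 | h1 <;> simp only [neg_zero, zero_add] at h1 <;> exact_mod_cast h1
          have h2' : 2 * (k : ℤ) * l = n * (2 * k) := by
            rcases h2 with h2 | h2 <;> simp only [neg_zero, zero_add] at h2 <;> exact_mod_cast h2
          have hm : m = k := mul_right_cancel₀ hlZ.ne' (by linarith)
          have hn : n = l := mul_right_cancel₀ hkZ.ne' (by linarith)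
          rw [hm, hn, Int.even_sub, Int.even_coe_nat, Int.even_coe_nat, ← Nat.even_add] at hmn
          exact (Nat.not_even_iff_odd.2 ho) hmn
      rw [hset, Set.encard_singleton]
    · rintro γ ⟨hγ, -, -, t₀, -, ht₀, -⟩
      obtain ⟨hfin, h4⟩ := f.quadruplePoints_eq hp hδ hμ₀ hμ₁ hc hγ ht₀
      refine ⟨hfin, ?_⟩
      -- The least common multiple of `2l` and `2k` is `2kl`, and their greatest common divisor is
      -- `2`.
      have hcard := EulerProblem.card_not_dvd_Ico (L := 2 * l) (K := 2 * k) (M := 2 * (k * l))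
        (r := 2) hp.pos_left hp.pos_right (by positivity) (by norm_num) (by ring) (by
          intro j
          constructor
          · rintro ⟨⟨a, rfl⟩, b, hb⟩
            have h1 : (l : ℤ) * a = k * b := by linarith
            obtain ⟨d, rfl⟩ := hkl'.dvd_of_dvd_mul_left ⟨b, h1⟩
            exact ⟨d, by ring⟩
          · rintro ⟨d, rfl⟩
            exact ⟨⟨k * d, by ring⟩, l * d, by ring⟩)
      rw [← h4] at hcard
      have hcard' : (4 : ℝ) * ((EulerProblem.quadruplePoints γ).ncard : ℝ) =
          2 * k * (2 * l) - 2 * k - 2 * l + 2 := by exact_mod_cast hcard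
      linarith
  · intro he
    obtain ⟨hp, hko, hlo⟩ := EulerProblem.isHalfPeriodPair_of_even_add hk hl hkl he
    obtain ⟨δ, hδ, e1, e2⟩ := EulerProblem.exists_time_unit (L := l) (K := k) hk hl hT₁ hR
      hp.pos_left (by ring)
    rw [e1, e2] at f
    have hshift : (k : ℝ) * (((l : ℤ) : ℝ) * δ) = l * (((k : ℤ) : ℝ) * δ) := by
      push_cast; ring
    refine ⟨?_, ?_⟩
    · have hmem : ∀ ε : ℝ, (ε = 1 ∨ ε = -1) →
          EulerProblem.brakeCurve P Y₁ Y₂ ε ∈ EulerProblem.brakeCollisionOrbits μ g c P := by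
        intro ε hε
        -- The collision time `klδ/2` is an odd multiple of both quarter periods, `k (h₁/2) = l
        -- (h₂/2)`, so both waves vanish there.
        refine ⟨f.brakeCurve_mem hμ₀ hμ₁ hc1 hε, f.periodic hp hδ hε,
          f.hasInverseSelfTangency hδ hε,
          ⟨0, f.mem_frontier hμ₀ hμ₁ hc1 hε 0 0 (by simp) (by simp)⟩, k * l * δ / 2, ?_⟩
        have z1 := f.lam_wave.half_eq_zero (m := k) (by exact_mod_cast hko)
        have z2 := f.nu_wave.half_eq_zero (m := l) (by exact_mod_cast hlo)
        have a1 : ((k : ℤ) : ℝ) * (((l : ℤ) : ℝ) * δ / 2) = k * l * δ / 2 := by push_cast; ring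
        have a2 : ((l : ℤ) : ℝ) * (((k : ℤ) : ℝ) * δ / 2) = k * l * δ / 2 := by push_cast; ring
        rw [a1] at z1
        rw [a2] at z2
        rw [EulerProblem.brakeCurve, z1, z2, mul_zero, EulerProblem.chart_zero]
      have hset : Set.range '' EulerProblem.brakeCollisionOrbits μ g c P =
          {Set.range (EulerProblem.brakeCurve P Y₁ Y₂ 1),
            Set.range (EulerProblem.brakeCurve P Y₁ Y₂ (-1))} := by
        ext S
        rw [Set.mem_insert_iff, Set.mem_singleton_iff]
        constructor
        · rintro ⟨γ, ⟨hγ, -, -, ⟨t₀, ht₀⟩, -⟩, rfl⟩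
          obtain ⟨ε, hε, he⟩ := f.exists_eq_brakeCurve hμ₀ hμ₁ hc hγ ht₀
          rw [EulerProblem.range_eq_of_shift he]
          rcases hε with rfl | rfl
          · exact Or.inl rfl
          · exact Or.inr rfl
        · rintro (rfl | rfl)
          · exact ⟨_, hmem 1 (Or.inl rfl), rfl⟩
          · exact ⟨_, hmem (-1) (Or.inr rfl), rfl⟩
      rw [hset, Set.encard_pair (f.range_ne hko hlo hshift)]
    · rintro γ ⟨hγ, -, -, ⟨t₀, ht₀⟩, -⟩
      obtain ⟨hfin, h4⟩ := f.quadruplePoints_eq hp hδ hμ₀ hμ₁ hc hγ ht₀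
      refine ⟨hfin, ?_⟩
      have hcard := EulerProblem.card_not_dvd_Ico (L := l) (K := k) (M := k * l)
        (r := 1) hp.pos_left hp.pos_right (by positivity) (by norm_num) (by ring) (by
          intro j
          exact ⟨fun h => hkl'.mul_dvd h.2 h.1,
            fun h => ⟨(Dvd.intro_left _ rfl).trans h, (Dvd.intro _ rfl).trans h⟩⟩)
      rw [← h4] at hcard
      have hcard' : (4 : ℝ) * ((EulerProblem.quadruplePoints γ).ncard : ℝ) =
          k * l - k - l + 1 := by exact_mod_cast hcard
      linarith
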